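/- Let $n\ge 1$ be an integer and $0<\delta\le n$. For $E\subset\mathbb R^n$ let $$\mathcal H^\delta_\infty(E)=\inf\Big\{\sum_i r_i^\delta : E\subset\bigcup_i B(x_i,r_i)\Big\}$$ be the $\delta$-dimensional Hausdorff content of $E$, where the infimum is over all countable or finite covers of $E$ by open balls. For an arbitrary (not necessarily measurable) function $g:\mathbb R^n\to[0,\infty]$ let $$\int_{\mathbb R^n} g\,d\mathcal H^\delta_\infty=\int_0^\infty \mathcal H^\delta_\infty(\{x\in\mathbb R^n: g(x)>t\})\,dt$$ be its Choquet integral. For $0<\alpha<n$ and an arbitrary function $f:\mathbb R^n\to[-\infty,\infty]$ define the Hausdorff content Riesz potential $$\mathcal R^n_\alpha f(x)=\int_{\mathbb R^n}\frac{|f(y)|}{|x-y|^{n-\alpha}}\,d\mathcal H^n_\infty(y),\qquad x\in\mathbb R^n,$$ the integral being a Choquet integral with respect to $\mathcal H^n_\infty$. **Theorem.** Let $n\ge1$, $\delta\in(0,n]$, $\alpha\in(0,\delta)$ and $p\in(\delta/n,\delta/\alpha)$. Then there is a finite constant $c$, depending only on $n$, $\delta$, $\alpha$ and $p$, such that for all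 functions $f:\mathbb R^n\to[-\infty,\infty]$ (measurable or not) $$\bigg(\int_{\mathbb R^n}\big(\mathcal R^n_\alpha f(x)\big)^{\frac{\delta p}{\delta-p\alpha}}\,d\mathcal H^\delta_\infty\bigg)^{\frac{\delta-p\alpha}{\delta p}}\le c\,\bigg(\int_{\mathbb R^n}|f(x)|^p\,d\mathcal H^\delta_\infty\bigg)^{\frac1p}.$$ -/

import Mathlib

open scoped ENNReal NNReal

/-- The `δ`-dimensional Hausdorff content of a set `s ⊆ ℝⁿ`: the infimum of `∑ rᵢ ^ δ` over all
countable or finite covers of `s` by open balls `B(xᵢ, rᵢ)`. A ball of radius `0` is empty, and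
`0 ^ δ = 0` for `δ > 0`, so that finite covers are those with `rᵢ = 0` for all large `i`. -/
noncomputable def hausdorffContent {n : ℕ} (δ : ℝ) (s : Set (EuclideanSpace ℝ (Fin n))) : ℝ≥0∞ :=
  ⨅ (x : ℕ → EuclideanSpace ℝ (Fin n)) (r : ℕ → ℝ≥0)
    (_ : s ⊆ ⋃ i, Metric.ball (x i) (r i : ℝ)), ∑' i, (r i : ℝ≥0∞) ^ δ

/-- The Choquet integral `∫_Ω f dH = ∫₀^∞ H {x ∈ Ω | f x > t} dt` of an arbitrary function
`f` with values in `[0, ∞]`, with respect to a set function `H`. -/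
noncomputable def choquetIntegral {X : Type*} (H : Set X → ℝ≥0∞) (Ω : Set X) (f : X → ℝ≥0∞) :
    ℝ≥0∞ :=
  ∫⁻ t in Set.Ioi (0 : ℝ), H {x ∈ Ω | ENNReal.ofReal t < f x}

/-- The Hausdorff content Riesz potential
`𝓡^δ_α f (x) = ∫_{ℝⁿ} |f y| / |x - y| ^ (δ - α) dH^δ_∞ (y)`, a Choquet integral. At the single
point `y = x`, which has content zero, the integrand is `∞` if `f x ≠ 0` and `0` if `f x = 0`. -/
noncomputable def rieszPotential {n : ℕ} (δ α : ℝ) (f : EuclideanSpace ℝ (Fin n) → EReal)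
    (x : EuclideanSpace ℝ (Fin n)) : ℝ≥0∞ :=
  choquetIntegral (hausdorffContent δ) Set.univ (fun y => (f y).abs / edist x y ^ (δ - α))

/-!
# Boundedness of the Hausdorff content Riesz potential

The proof rests on the following fact about the Choquet integral of the content `H^δ`: if
`g ≤ ∑ aᵢ χ_{Bᵢ}` with balls `Bᵢ` of radii `rᵢ`, then `∫ g dH^δ ≤ C ∑ aᵢ rᵢ ^ δ`
(`IsBallDominated.choquetIntegral_le`). For dyadic cubes instead of balls the constant comes only
from comparing a cube with a ball: the sum of the coefficients along the chain of cubes containing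
a point crosses the height `t` at one cube, and a cube `Q` is used in this way for a set of heights
`t` of measure at most `a_Q` (`choquetIntegral_le_of_le_dyadic`). So, up to constants, the Choquet
integral is countably subadditive, for arbitrary functions and without any measure theory in
`ℝⁿ`, and every estimate below is made on superpositions of balls.

Write `F = |f|`. The superlevel sets `E_k = {F > 2 ^ k}` are covered by balls `B_{k,i}` with
`∑ₖ 2 ^ (p k) ∑ᵢ r_{k,i} ^ δ ≤ A`, for any given `A > C ∫ F ^ p dH^δ`
(`exists_superlevel_covers`). For `m ∈ ℤ` let `ρ_m = (A 2 ^ (-p m)) ^ (1 / δ)` and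
`λ_m = 2 ^ m ρ_m ^ α`. The potential of `F` is at most `C (λ_m + W_m)`, where `W_m` collects the
contributions at scales below `ρ_m` of the balls with `k ≥ m` (`exists_potential_le`).
* The levels `k < m` contribute at most `C ∑_{k < m} 2 ^ k ρ_k ^ α ≤ C λ_m`, since the potential of
  a set of `H^n` content at most `ρ ^ n` is at most `C ρ ^ α`; the series converges as `p < δ / α`.
* The tails of the potentials of the balls with `k ≥ m` contribute at most
  `C ρ_m ^ (α - n) ∑_{k ≥ m} 2 ^ k ρ_k ^ n ≤ C λ_m`; this series converges as `p > δ / n`.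

With `s = δ / n ≤ 1` the function `W_m ^ s` may be estimated ball by ball, which gives
`2 ^ (s m) H^δ {W_m > λ_m} ≤ C ∑_{k ≥ m} 2 ^ (s k) ∑ᵢ r_{k,i} ^ δ`
(`exists_content_localPotential_le`). As `λ_m ^ q` is a multiple of `2 ^ (p m)` for
`q = δ p / (δ - p α)`, multiplying by `2 ^ ((p - s) m)` and summing over `m` yields the theorem
(`exists_choquetIntegral_potential_le`). Radii and heights are written as powers of two, so that
`A = 2 ^ (δ τ)` and `ρ_m = 2 ^ (τ - p m / δ)`.
-/

/-! ### Dyadic cubes and the Choquet integral of a superposition of cubes -/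

/-- The index of the half-open dyadic cube of side `2⁻ʲ` that contains `x`. -/
noncomputable def dyadicIndex {n : ℕ} (j : ℤ) (x : EuclideanSpace ℝ (Fin n)) : Fin n → ℤ :=
  fun i => ⌊(2 : ℝ) ^ j * x i⌋

/-- The lower corner of the dyadic cube of side `2⁻ʲ` with index `v`. -/
noncomputable def dyadicCorner {n : ℕ} (j : ℤ) (v : Fin n → ℤ) : EuclideanSpace ℝ (Fin n) :=
  WithLp.toLp 2 fun i => (2 : ℝ) ^ (-j) * v i

lemma dyadicIndex_dyadicCorner {n : ℕ} (j : ℤ) (v : Fin n → ℤ) :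
    dyadicIndex j (dyadicCorner j v) = v := by
  funext i
  simp only [dyadicIndex, dyadicCorner]
  rw [← mul_assoc, ← zpow_add₀ two_ne_zero]
  simp

/-- Dyadic cubes are nested: a cube determines all larger ones that contain it. -/
lemma dyadicIndex_eq_of_le {n : ℕ} {i j : ℤ} (hij : i ≤ j) {x y : EuclideanSpace ℝ (Fin n)}
    (h : dyadicIndex j x = dyadicIndex j y) : dyadicIndex i x = dyadicIndex i y := by
  obtain ⟨k, rfl⟩ := Int.le.dest hij
  have key : ∀ t : ℝ, ⌊(2 : ℝ) ^ i * t⌋ = ⌊(2 : ℝ) ^ (i + (k : ℤ)) * t⌋ / ((2 ^ k : ℕ) : ℤ) := by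
    intro t
    rw [← Int.floor_div_natCast]
    congr 1
    rw [zpow_add₀ two_ne_zero]
    push_cast
    rw [zpow_natCast]
    field_simp
  funext l
  have hl := congrFun h l
  simp only [dyadicIndex] at hl ⊢
  rw [key, key, hl]

lemma dist_dyadicCorner_lt {n : ℕ} (j : ℤ) (x : EuclideanSpace ℝ (Fin n)) :
    dist x (dyadicCorner j (dyadicIndex j x)) < (n + 1) * (2 : ℝ) ^ (-j) := by
  have h2 : (0 : ℝ) < 2 ^ (-j) := by positivity
  have hc : ∀ i, (x i - (dyadicCorner j (dyadicIndex j x)) i) ^ 2 ≤ ((2 : ℝ) ^ (-j)) ^ 2 := by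
    intro i
    have hx : x i = (2 : ℝ) ^ (-j) * ((2 : ℝ) ^ j * x i) := by
      rw [← mul_assoc, ← zpow_add₀ two_ne_zero]; simp
    have hfl := Int.floor_le ((2 : ℝ) ^ j * x i)
    have hlt := Int.lt_floor_add_one ((2 : ℝ) ^ j * x i)
    have e : x i - (dyadicCorner j (dyadicIndex j x)) i
        = (2 : ℝ) ^ (-j) * ((2 : ℝ) ^ j * x i - ⌊(2 : ℝ) ^ j * x i⌋) := by
      rw [mul_sub, ← hx]; rfl
    rw [e, mul_pow]
    refine mul_le_of_le_one_right (by positivity) ?_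
    exact pow_le_one₀ (by linarith) (by linarith)
  rw [EuclideanSpace.dist_eq]
  refine (Real.sqrt_le_sqrt (Finset.sum_le_sum (g := fun _ => ((2 : ℝ) ^ (-j)) ^ 2)
    fun i _ => ?_)).trans_lt ?_
  · rw [Real.dist_eq, sq_abs]; exact hc i
  · rw [Finset.sum_const, Finset.card_univ, Fintype.card_fin, nsmul_eq_mul]
    refine (Real.sqrt_lt' (by positivity)).2 ?_
    rw [mul_pow]
    have : (n : ℝ) < (n + 1) ^ 2 := by nlinarith [(Nat.cast_nonneg n : (0 : ℝ) ≤ n)]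
    exact mul_lt_mul_of_pos_right this (by positivity)

/-- Neighbouring points lie in neighbouring cubes. -/
lemma dyadicIndex_sub_mem {n : ℕ} {j : ℤ} {x z : EuclideanSpace ℝ (Fin n)}
    (h : dist x z ≤ (2 : ℝ) ^ (-j)) :
    dyadicIndex j x - dyadicIndex j z ∈
      Fintype.piFinset fun _ : Fin n => Finset.Icc (-1 : ℤ) 1 := by
  rw [Fintype.mem_piFinset]
  intro i
  have h1 : |x i - z i| ≤ (2 : ℝ) ^ (-j) := by
    rw [← Real.dist_eq]
    exact (PiLp.dist_apply_le x z i).trans h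
  have h2 : |(2 : ℝ) ^ j * x i - (2 : ℝ) ^ j * z i| ≤ 1 := by
    rw [← mul_sub, abs_mul, abs_of_pos (by positivity)]
    calc (2 : ℝ) ^ j * |x i - z i| ≤ 2 ^ j * 2 ^ (-j) := by gcongr
      _ = 1 := by rw [← zpow_add₀ two_ne_zero]; simp
  rw [abs_le] at h2
  simp only [Pi.sub_apply, dyadicIndex, Finset.mem_Icc]
  have a1 := Int.floor_le ((2 : ℝ) ^ j * x i)
  have a2 := Int.lt_floor_add_one ((2 : ℝ) ^ j * x i)
  have b1 := Int.floor_le ((2 : ℝ) ^ j * z i)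
  have b2 := Int.lt_floor_add_one ((2 : ℝ) ^ j * z i)
  constructor
  · have : ((⌊(2 : ℝ) ^ j * z i⌋ : ℤ) : ℝ) < ⌊(2 : ℝ) ^ j * x i⌋ + 2 := by linarith
    have : ⌊(2 : ℝ) ^ j * z i⌋ < ⌊(2 : ℝ) ^ j * x i⌋ + 2 := by exact_mod_cast this
    omega
  · have : ((⌊(2 : ℝ) ^ j * x i⌋ : ℤ) : ℝ) < ⌊(2 : ℝ) ^ j * z i⌋ + 2 := by linarith
    have : ⌊(2 : ℝ) ^ j * x i⌋ < ⌊(2 : ℝ) ^ j * z i⌋ + 2 := by exact_mod_cast this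
    omega

lemma hausdorffContent_mono {n : ℕ} (δ : ℝ) {s t : Set (EuclideanSpace ℝ (Fin n))} (h : s ⊆ t) :
    hausdorffContent δ s ≤ hausdorffContent δ t :=
  iInf_mono fun _ => iInf_mono fun _ => iInf_mono' fun ht => ⟨h.trans ht, le_rfl⟩

lemma hausdorffContent_le_tsum {n : ℕ} {δ : ℝ} (hδ : 0 < δ) {ι : Type*} [Countable ι]
    {s : Set (EuclideanSpace ℝ (Fin n))} (x : ι → EuclideanSpace ℝ (Fin n)) (r : ι → ℝ≥0)
    (h : s ⊆ ⋃ i, Metric.ball (x i) (r i : ℝ)) :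
    hausdorffContent δ s ≤ ∑' i, (r i : ℝ≥0∞) ^ δ := by
  obtain ⟨e, he⟩ := Countable.exists_injective_nat ι
  refine (iInf₂_le_of_le (Function.extend e x 0) (Function.extend e r 0) <|
    iInf_le_of_le ?_ le_rfl).trans (le_of_eq ?_)
  · refine h.trans (Set.iUnion_subset fun i => ?_)
    refine Set.subset_iUnion_of_subset (e i) ?_
    rw [he.extend_apply, he.extend_apply]
  · rw [← he.tsum_eq]
    · simp [he.extend_apply]
    · intro k hk
      by_contra hcon
      apply hk
      have : ¬ ∃ a, e a = k := fun ⟨a, ha⟩ => hcon ⟨a, ha⟩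
      simp [Function.extend_apply' _ _ _ this, ENNReal.zero_rpow_of_pos hδ]

lemma tsum_ite_lt_add_one (u : ℤ → ℝ≥0∞) (j : ℤ) :
    (∑' i, if i < j + 1 then u i else 0) = (∑' i, if i < j then u i else 0) + u j := by
  have : ∀ i, (if i < j + 1 then u i else 0)
      = (if i < j then u i else 0) + (if i = j then u j else 0) := by
    intro i
    rcases lt_trichotomy i j with h | h | h
    · rw [if_pos (by omega), if_pos h, if_neg (by omega), add_zero]
    · subst h; simp
    · rw [if_neg (by omega), if_neg (by omega), if_neg (by omega), add_zero]
  simp_rw [this]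
  rw [ENNReal.tsum_add, tsum_ite_eq]

/-- A level `t` below the sum of a two-sided sequence is crossed by one of its partial sums. -/
lemma exists_tsum_ite_le_lt {u : ℤ → ℝ≥0∞} {t : ℝ≥0∞} (ht0 : t ≠ 0) (ht : t < ∑' i, u i)
    (hu : (∑' i, if i < 0 then u i else 0) ≠ ∞) :
    ∃ j, (∑' i, if i < j then u i else 0) ≤ t ∧ t < (∑' i, if i < j then u i else 0) + u j := by
  have hne : ∃ j, t < ∑' i, if i < j then u i else 0 := by
    rw [ENNReal.tsum_eq_iSup_sum, lt_iSup_iff] at ht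
    obtain ⟨s, hs⟩ := ht
    obtain ⟨M, hM⟩ := s.bddAbove
    refine ⟨M + 1, hs.trans_le ?_⟩
    refine le_trans (le_of_eq ?_) (ENNReal.sum_le_tsum s)
    refine Finset.sum_congr rfl fun i hi => ?_
    have := hM hi
    rw [if_pos (by omega)]
  have hbd : ∃ b : ℤ, ∀ j, t < (∑' i, if i < j then u i else 0) → b ≤ j := by
    have h1 := ENNReal.tendsto_tsum_compl_atTop_zero hu
    obtain ⟨s, hs⟩ := (h1.eventually (gt_mem_nhds (pos_iff_ne_zero.2 ht0))).exists
    obtain ⟨m, hm⟩ := s.bddBelow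
    refine ⟨min m 0, fun j hj => ?_⟩
    by_contra hlt
    push Not at hlt
    refine absurd hj (not_lt.2 (le_trans ?_ hs.le))
    refine le_trans ?_ (tsum_subtype {x | x ∉ s} (fun i => if i < 0 then u i else 0)).ge
    refine ENNReal.tsum_le_tsum fun i => ?_
    split_ifs with hi
    · have him : i ∉ s := fun hmem => by
        have := hm hmem
        have := min_le_left m 0
        omega
      rw [Set.indicator_of_mem (by exact him), if_pos]
      have := min_le_right m 0
      omega
    · exact zero_le
  obtain ⟨b, hb⟩ := hbd
  obtain ⟨j, hj, hmin⟩ := Int.exists_least_of_bdd ⟨b, hb⟩ hne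
  refine ⟨j - 1, ?_, ?_⟩
  · by_contra hcon
    have := hmin _ (not_le.1 hcon)
    omega
  · rw [← tsum_ite_lt_add_one, sub_add_cancel]
    exact hj

lemma volume_levels_le (P a : ℝ≥0∞) :
    MeasureTheory.volume
      ({t : ℝ | P ≤ ENNReal.ofReal t ∧ ENNReal.ofReal t < P + a} ∩ Set.Ioi 0) ≤ a := by
  by_cases hP : P = ∞
  · simp [hP]
  by_cases ha : a = ∞
  · simp [ha]
  lift P to ℝ≥0 using hP
  lift a to ℝ≥0 using ha
  have hsub : ({t : ℝ | (P : ℝ≥0∞) ≤ ENNReal.ofReal t ∧ ENNReal.ofReal t < P + a} ∩ Set.Ioi 0)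
      ⊆ Set.Ico (P : ℝ) (P + a) := by
    rintro t ⟨⟨h1, h2⟩, h0⟩
    have h0' : (0 : ℝ) ≤ t := le_of_lt h0
    lift t to ℝ≥0 using h0'
    rw [ENNReal.ofReal_coe_nnreal] at h1 h2
    exact ⟨by exact_mod_cast h1, by exact_mod_cast h2⟩
  refine (MeasureTheory.measure_mono hsub).trans ?_
  simp

/-- If `g` is at most a superposition of dyadic cubes, its Choquet integral is at most the
corresponding sum of contents. The prefix sum over the cubes that strictly contain a cube `Q` is
constant on `Q`, so at height `t` one may cover `{g > t}` by those `Q` at which the sum along the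
chain of cubes crosses `t`; each `Q` is used for a set of heights of measure at most its
coefficient. -/
lemma choquetIntegral_le_of_le_dyadic {n : ℕ} {δ : ℝ} (hδ : 0 < δ)
    {g : EuclideanSpace ℝ (Fin n) → ℝ≥0∞} (a : ℤ → (Fin n → ℤ) → ℝ≥0∞)
    (hg : ∀ x, g x ≤ ∑' j, a j (dyadicIndex j x)) (c : ℤ → ℝ≥0)
    (hc : ∀ j, (c j : ℝ) = (n + 1) * (2 : ℝ) ^ (-j)) :
    choquetIntegral (hausdorffContent δ) Set.univ g
      ≤ ∑' Q : ℤ × (Fin n → ℤ), a Q.1 Q.2 * (c Q.1 : ℝ≥0∞) ^ δ := by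
  by_cases hfin : ∑' Q : ℤ × (Fin n → ℤ), a Q.1 Q.2 * (c Q.1 : ℝ≥0∞) ^ δ = ∞
  · rw [hfin]; exact le_top
  -- large cubes have volume at least one, hence summable coefficients
  have hlow : ∀ x : EuclideanSpace ℝ (Fin n),
      (∑' i, if i < 0 then a i (dyadicIndex i x) else 0) ≠ ∞ := by
    intro x
    refine ne_top_of_le_ne_top hfin ?_
    rw [ENNReal.tsum_prod (f := fun (j : ℤ) (v : Fin n → ℤ) => a j v * (c j : ℝ≥0∞) ^ δ)]
    refine ENNReal.tsum_le_tsum fun i => ?_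
    split_ifs with hi
    · refine le_trans ?_ (ENNReal.le_tsum (dyadicIndex i x))
      refine le_mul_of_one_le_right' (ENNReal.one_le_rpow ?_ hδ)
      have h1 : (1 : ℝ) ≤ c i := by
        rw [hc]
        have : (1 : ℝ) ≤ 2 ^ (-i) := one_le_zpow₀ (by norm_num) (by omega)
        nlinarith [(Nat.cast_nonneg n : (0 : ℝ) ≤ n)]
      exact_mod_cast h1
    · exact zero_le
  set P : ℤ × (Fin n → ℤ) → ℝ≥0∞ := fun Q =>
    ∑' i, if i < Q.1 then a i (dyadicIndex i (dyadicCorner Q.1 Q.2)) else 0 with hPdef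
  have hP : ∀ j x, P (j, dyadicIndex j x) = ∑' i, if i < j then a i (dyadicIndex i x) else 0 := by
    intro j x
    refine tsum_congr fun i => ?_
    split_ifs with hi
    · rw [dyadicIndex_eq_of_le hi.le (dyadicIndex_dyadicCorner j (dyadicIndex j x))]
    · rfl
  set T : ℤ × (Fin n → ℤ) → Set ℝ := fun Q =>
    {t : ℝ | P Q ≤ ENNReal.ofReal t ∧ ENNReal.ofReal t < P Q + a Q.1 Q.2} with hTdef
  have hT : ∀ Q, MeasurableSet (T Q) := fun Q =>
    (measurableSet_le measurable_const ENNReal.measurable_ofReal).inter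
      (measurableSet_lt ENNReal.measurable_ofReal measurable_const)
  have key : ∀ t ∈ Set.Ioi (0 : ℝ),
      hausdorffContent δ {x ∈ Set.univ | ENNReal.ofReal t < g x}
        ≤ ∑' Q, (T Q).indicator (fun _ => (c Q.1 : ℝ≥0∞) ^ δ) t := by
    intro t ht
    classical
    refine (hausdorffContent_le_tsum hδ (fun Q : ℤ × (Fin n → ℤ) => dyadicCorner Q.1 Q.2)
      (fun Q => if t ∈ T Q then c Q.1 else 0) ?_).trans (le_of_eq (tsum_congr fun Q => ?_))
    · rintro x ⟨-, hx⟩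
      obtain ⟨j, hj1, hj2⟩ := exists_tsum_ite_le_lt (ENNReal.ofReal_pos.2 ht).ne'
        (hx.trans_le (hg x)) (hlow x)
      refine Set.mem_iUnion.2 ⟨(j, dyadicIndex j x), ?_⟩
      have hmem : t ∈ T (j, dyadicIndex j x) := by
        simp only [hTdef, Set.mem_ofPred_eq, hP]
        exact ⟨hj1, hj2⟩
      simp only [if_pos hmem, Metric.mem_ball, hc]
      exact dist_dyadicCorner_lt j x
    · by_cases h : t ∈ T Q
      · simp [h]
      · simp [h, hδ]
  calc choquetIntegral (hausdorffContent δ) Set.univ g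
      ≤ ∫⁻ t in Set.Ioi (0 : ℝ), ∑' Q, (T Q).indicator (fun _ => (c Q.1 : ℝ≥0∞) ^ δ) t :=
        MeasureTheory.setLIntegral_mono' measurableSet_Ioi key
    _ = ∑' Q, ∫⁻ t in Set.Ioi (0 : ℝ), (T Q).indicator (fun _ => (c Q.1 : ℝ≥0∞) ^ δ) t :=
        MeasureTheory.lintegral_tsum fun Q => (measurable_const.indicator (hT Q)).aemeasurable
    _ ≤ _ := by
        refine ENNReal.tsum_le_tsum fun Q => ?_
        rw [MeasureTheory.lintegral_indicator_const (hT Q),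
          MeasureTheory.Measure.restrict_apply (hT Q), mul_comm]
        gcongr
        exact volume_levels_le _ _

/-! ### Domination by superpositions of balls -/

/-- `g` is at most a superposition `∑ a(z, r) χ_{B(z, r)}` of balls with
`∑ a(z, r) r ^ δ ≤ M`. The sums run over all balls; they have countable support when finite. -/
def IsBallDominated {n : ℕ} (δ : ℝ) (g : EuclideanSpace ℝ (Fin n) → ℝ≥0∞) (M : ℝ≥0∞) : Prop :=
  ∃ a : EuclideanSpace ℝ (Fin n) × ℝ≥0 → ℝ≥0∞,
    (∀ y, g y ≤ ∑' b, a b * (Metric.ball b.1 (b.2 : ℝ)).indicator 1 y) ∧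
      ∑' b, a b * (b.2 : ℝ≥0∞) ^ δ ≤ M

namespace IsBallDominated

variable {n : ℕ} {δ : ℝ} {g h : EuclideanSpace ℝ (Fin n) → ℝ≥0∞} {M N : ℝ≥0∞}

lemma mono (hh : IsBallDominated δ h M) (hg : ∀ y, g y ≤ h y) (hM : M ≤ N) :
    IsBallDominated δ g N :=
  let ⟨a, h1, h2⟩ := hh
  ⟨a, fun y => (hg y).trans (h1 y), h2.trans hM⟩

lemma const_mul (hg : IsBallDominated δ g M) (c : ℝ≥0∞) :
    IsBallDominated δ (fun y => c * g y) (c * M) := by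
  obtain ⟨a, h1, h2⟩ := hg
  refine ⟨fun b => c * a b, fun y => ?_, ?_⟩
  · simp_rw [mul_assoc, ENNReal.tsum_mul_left]
    gcongr
    exact h1 y
  · simp_rw [mul_assoc, ENNReal.tsum_mul_left]
    gcongr

lemma tsum {ι : Type*} {G : ι → EuclideanSpace ℝ (Fin n) → ℝ≥0∞} {B : ι → ℝ≥0∞}
    (hG : ∀ i, IsBallDominated δ (G i) (B i)) :
    IsBallDominated δ (fun y => ∑' i, G i y) (∑' i, B i) := by
  choose a h1 h2 using hG
  refine ⟨fun b => ∑' i, a i b, fun y => ?_, ?_⟩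
  · simp_rw [← ENNReal.tsum_mul_right]
    rw [ENNReal.tsum_comm]
    exact ENNReal.tsum_le_tsum fun i => h1 i y
  · simp_rw [← ENNReal.tsum_mul_right]
    rw [ENNReal.tsum_comm]
    exact ENNReal.tsum_le_tsum fun i => h2 i

lemma add (hg : IsBallDominated δ g M) (hh : IsBallDominated δ h N) :
    IsBallDominated δ (fun y => g y + h y) (M + N) := by
  have := tsum (δ := δ) (G := fun (i : Bool) => if i then g else h)
    (B := fun i => if i then M else N) (by rintro (_ | _) <;> simpa)
  simp only [tsum_bool] at this
  simpa [add_comm] using this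

lemma ball (δ : ℝ) (z : EuclideanSpace ℝ (Fin n)) (r : ℝ≥0) :
    IsBallDominated δ ((Metric.ball z (r : ℝ)).indicator 1) ((r : ℝ≥0∞) ^ δ) := by
  classical
  refine ⟨fun b => if b = (z, r) then 1 else 0, fun y => ?_, ?_⟩
  · simp_rw [ite_mul, zero_mul]
    rw [tsum_ite_eq]
    simp
  · simp_rw [ite_mul, zero_mul]
    rw [tsum_ite_eq]
    simp

end IsBallDominated

/-- A ball is contained in at most `3ⁿ` dyadic cubes of comparable size, so the bound for
superpositions of dyadic cubes carries over to balls. -/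
lemma IsBallDominated.choquetIntegral_le {n : ℕ} {δ : ℝ} (hδ : 0 < δ) :
    ∃ C : ℝ≥0, ∀ (g : EuclideanSpace ℝ (Fin n) → ℝ≥0∞) (M : ℝ≥0∞), IsBallDominated δ g M →
      choquetIntegral (hausdorffContent δ) Set.univ g ≤ C * M := by
  classical
  -- the indices of a cube and its neighbours, relative to that cube
  set N : Finset (Fin n → ℤ) := Fintype.piFinset fun _ : Fin n => Finset.Icc (-1 : ℤ) 1 with hN
  have hlev : ∀ r : ℝ≥0, ∃ j : ℤ, r ≠ 0 → (r : ℝ) ≤ 2 ^ (-j) ∧ (2 : ℝ) ^ (-j) ≤ 2 * r := by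
    intro r
    by_cases hr : r = 0
    · exact ⟨0, fun h => absurd hr h⟩
    obtain ⟨k, hk1, hk2⟩ := exists_mem_Ioc_zpow (NNReal.coe_pos.2 (pos_iff_ne_zero.2 hr))
      (one_lt_two : (1 : ℝ) < 2)
    refine ⟨-(k + 1), fun _ => ⟨by simpa using hk2, ?_⟩⟩
    rw [neg_neg, zpow_add_one₀ two_ne_zero]
    linarith
  choose lev hlev using hlev
  let c : ℤ → ℝ≥0 := fun j => (n + 1) * (2 : ℝ≥0) ^ (-j)
  refine ⟨N.card * (2 * (n + 1)) ^ δ, ?_⟩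
  rintro g M ⟨a, hg, hM⟩
  -- balls of radius zero are empty and have no level, so their coefficients are dropped
  let w : EuclideanSpace ℝ (Fin n) × ℝ≥0 → ℝ≥0∞ := fun b => if b.2 = 0 then 0 else a b
  let A : ℤ → (Fin n → ℤ) → ℝ≥0∞ := fun j v => ∑' b : EuclideanSpace ℝ (Fin n) × ℝ≥0,
    if j = lev b.2 ∧ v - dyadicIndex j b.1 ∈ N then w b else 0
  refine (choquetIntegral_le_of_le_dyadic hδ A (fun y => (hg y).trans ?_) c ?_).trans ?_
  · simp only [A]
    rw [ENNReal.tsum_comm]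
    refine ENNReal.tsum_le_tsum fun b => ?_
    by_cases hy : y ∈ Metric.ball b.1 (b.2 : ℝ)
    · have hb : b.2 ≠ 0 := by
        rintro h0
        simp [h0] at hy
      refine le_trans ?_ (ENNReal.le_tsum (lev b.2))
      have hd : dyadicIndex (lev b.2) y - dyadicIndex (lev b.2) b.1 ∈ N :=
        dyadicIndex_sub_mem ((Metric.mem_ball.1 hy).le.trans (hlev _ hb).1)
      rw [if_pos ⟨rfl, hd⟩]
      simp [w, hb, hy]
    · simp [hy]
  · intro j
    simp [c]
  · simp only [A]
    simp_rw [← ENNReal.tsum_mul_right]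
    rw [ENNReal.tsum_comm]
    refine le_trans (ENNReal.tsum_le_tsum fun b => ?_) (le_of_eq_of_le
      (ENNReal.tsum_mul_left (a := ((N.card * (2 * (n + 1)) ^ δ : ℝ≥0) : ℝ≥0∞))) (by gcongr))
    rw [ENNReal.tsum_prod (f := fun (j : ℤ) (v : Fin n → ℤ) =>
      (if j = lev b.2 ∧ v - dyadicIndex j b.1 ∈ N then w b else 0) * (c j : ℝ≥0∞) ^ δ)]
    rw [tsum_eq_single (lev b.2) (by intro j hj; simp [hj])]
    rw [← (Equiv.addRight (dyadicIndex (lev b.2) b.1)).tsum_eq]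
    simp only [Equiv.coe_addRight, add_sub_cancel_right, true_and]
    rw [tsum_eq_sum (s := N) (by intro v hv; simp [hv])]
    rw [Finset.sum_congr rfl (g := fun _ => w b * (c (lev b.2) : ℝ≥0∞) ^ δ)
      (by intro v hv; rw [if_pos hv])]
    rw [Finset.sum_const, nsmul_eq_mul]
    by_cases hb : b.2 = 0
    · simp [w, hb]
    have hcb : c (lev b.2) ≤ 2 * (n + 1) * b.2 := by
      have h2 := (hlev _ hb).2
      rw [← NNReal.coe_le_coe]
      push_cast [c]
      nlinarith [(Nat.cast_nonneg n : (0 : ℝ) ≤ n)]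
    calc (N.card : ℝ≥0∞) * (w b * (c (lev b.2) : ℝ≥0∞) ^ δ)
        ≤ N.card * (a b * ((2 * (n + 1) * b.2 : ℝ≥0) : ℝ≥0∞) ^ δ) := by
          simp only [w, if_neg hb]
          gcongr
      _ = _ := by
          rw [ENNReal.coe_mul, ENNReal.mul_rpow_of_nonneg _ _ hδ.le, ENNReal.coe_mul N.card,
            ENNReal.coe_rpow_of_nonneg _ hδ.le]
          push_cast
          ring

/-- Markov's inequality for the content. -/
lemma IsBallDominated.hausdorffContent_le {n : ℕ} {δ : ℝ} (hδ : 0 < δ) :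
    ∃ C : ℝ≥0, ∀ (g : EuclideanSpace ℝ (Fin n) → ℝ≥0∞) (M : ℝ≥0∞), IsBallDominated δ g M →
      ∀ t : ℝ≥0∞, t ≠ ∞ → t * hausdorffContent δ {x | t < g x} ≤ C * M := by
  obtain ⟨C, hC⟩ := IsBallDominated.choquetIntegral_le (n := n) hδ
  refine ⟨C, fun g M hg t ht => le_trans ?_ (hC g M hg)⟩
  lift t to ℝ≥0 using ht
  calc (t : ℝ≥0∞) * hausdorffContent δ {x | (t : ℝ≥0∞) < g x}
      = ∫⁻ _ in Set.Ioc (0 : ℝ) t, hausdorffContent δ {x | (t : ℝ≥0∞) < g x} := by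
        rw [MeasureTheory.setLIntegral_const, Real.volume_Ioc, sub_zero,
          ENNReal.ofReal_coe_nnreal, mul_comm]
    _ ≤ ∫⁻ u in Set.Ioc (0 : ℝ) t,
          hausdorffContent δ {x ∈ Set.univ | ENNReal.ofReal u < g x} := by
        refine MeasureTheory.setLIntegral_mono' measurableSet_Ioc fun u hu => ?_
        refine hausdorffContent_mono δ fun x hx => ⟨trivial, lt_of_le_of_lt ?_ hx⟩
        rw [← ENNReal.ofReal_coe_nnreal]
        exact ENNReal.ofReal_le_ofReal hu.2
    _ ≤ _ := MeasureTheory.lintegral_mono_set Set.Ioc_subset_Ioi_self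

/-! ### The Riesz kernel -/

lemma two_rpow_mul (x y : ℝ) : (2 : ℝ≥0∞) ^ x * 2 ^ y = 2 ^ (x + y) :=
  (ENNReal.rpow_add x y two_ne_zero ENNReal.ofNat_ne_top).symm

lemma two_rpow_ne_zero (x : ℝ) : (2 : ℝ≥0∞) ^ x ≠ 0 := by
  simp [ENNReal.rpow_eq_zero_iff]

lemma two_rpow_ne_top (x : ℝ) : (2 : ℝ≥0∞) ^ x ≠ ∞ := by
  simp [ENNReal.rpow_eq_top_iff]

lemma two_rpow_mono {x y : ℝ} (h : x ≤ y) : (2 : ℝ≥0∞) ^ x ≤ 2 ^ y :=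
  ENNReal.rpow_le_rpow_of_exponent_le one_le_two h

lemma exists_two_rpow_eq {r : ℝ≥0} (hr : r ≠ 0) : ∃ u : ℝ, (2 : ℝ≥0∞) ^ u = r := by
  refine ⟨Real.logb 2 r, ?_⟩
  rw [show (2 : ℝ≥0∞) = ((2 : ℝ≥0) : ℝ≥0∞) by norm_cast,
    ← ENNReal.coe_rpow_of_ne_zero two_ne_zero]
  congr 1
  refine NNReal.eq ?_
  rw [NNReal.coe_rpow]
  exact Real.rpow_logb (by norm_num) (by norm_num) (NNReal.coe_pos.2 (pos_iff_ne_zero.2 hr))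

lemma rpow_neg_anti {β : ℝ} (hβ : 0 ≤ β) {a b : ℝ≥0∞} (h : a ≤ b) : b ^ (-β) ≤ a ^ (-β) := by
  rw [ENNReal.rpow_neg, ENNReal.rpow_neg]
  exact ENNReal.inv_le_inv.2 (ENNReal.rpow_le_rpow h hβ)

lemma exists_tsum_two_rpow_le {θ : ℝ} (hθ : 0 < θ) :
    ∃ C : ℝ≥0, ∑' i : ℕ, (2 : ℝ≥0∞) ^ (-(θ * i)) ≤ C := by
  have h : ∀ i : ℕ, (2 : ℝ≥0∞) ^ (-(θ * i)) = ((2 : ℝ≥0∞) ^ (-θ)) ^ i := by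
    intro i
    rw [← ENNReal.rpow_natCast, ← ENNReal.rpow_mul]
    congr 1; ring
  simp_rw [h]
  rw [ENNReal.tsum_geometric]
  have hlt : (2 : ℝ≥0∞) ^ (-θ) < 1 :=
    ENNReal.rpow_lt_one_of_one_lt_of_neg (by norm_num) (by linarith)
  have hne : (1 - (2 : ℝ≥0∞) ^ (-θ))⁻¹ ≠ ∞ := ENNReal.inv_ne_top.2 (tsub_pos_of_lt hlt).ne'
  exact ⟨_, (ENNReal.coe_toNNReal hne).ge⟩

lemma exists_tsum_int_le {θ : ℝ} (hθ : 0 < θ) :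
    ∃ C : ℝ≥0, ∀ m : ℤ, (∑' k : ℤ, if k ≤ m then (2 : ℝ≥0∞) ^ (θ * k) else 0)
      ≤ C * 2 ^ (θ * m) := by
  obtain ⟨C, hC⟩ := exists_tsum_two_rpow_le hθ
  refine ⟨C, fun m => ?_⟩
  have hinj : Function.Injective fun i : ℕ => m - (i : ℤ) := fun a b h => by simpa using h
  rw [← hinj.tsum_eq]
  · refine le_trans (le_of_eq ?_) (mul_le_mul_left hC _)
    rw [← ENNReal.tsum_mul_right]
    refine tsum_congr fun i => ?_
    rw [if_pos (by omega), two_rpow_mul]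
    congr 1
    push_cast
    ring
  · intro k hk
    have : k ≤ m := by
      by_contra h
      simp [h] at hk
    exact ⟨(m - k).toNat, by simp; omega⟩

lemma exists_tsum_int_le' {θ : ℝ} (hθ : 0 < θ) :
    ∃ C : ℝ≥0, ∀ m : ℤ, (∑' k : ℤ, if m ≤ k then (2 : ℝ≥0∞) ^ (-(θ * k)) else 0)
      ≤ C * 2 ^ (-(θ * m)) := by
  obtain ⟨C, hC⟩ := exists_tsum_int_le hθ
  refine ⟨C, fun m => ?_⟩
  rw [← (Equiv.neg ℤ).tsum_eq]
  have := hC (-m)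
  simp only [Equiv.neg_apply]
  refine le_trans (le_of_eq (tsum_congr fun k => ?_)) (this.trans (le_of_eq ?_))
  · by_cases h : m ≤ -k
    · rw [if_pos h, if_pos (by omega)]; push_cast; congr 1; ring
    · rw [if_neg h, if_neg (by omega)]
  · push_cast; congr 2; ring

lemma tsum_rpow_le {ι : Type*} {s : ℝ} (hs0 : 0 < s) (hs1 : s ≤ 1) (f : ι → ℝ≥0∞) :
    (∑' i, f i) ^ s ≤ ∑' i, f i ^ s := by
  have h : ∀ t : Finset ι, (∑ i ∈ t, f i) ^ s ≤ ∑ i ∈ t, f i ^ s := by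
    classical
    intro t
    induction t using Finset.induction_on with
    | empty => simp [hs0]
    | insert a t ha ih =>
      rw [Finset.sum_insert ha, Finset.sum_insert ha]
      exact (ENNReal.rpow_add_le_add_rpow _ _ hs0.le hs1).trans (by gcongr)
  have ht := (ENNReal.continuous_rpow_const (y := s)).continuousAt.tendsto.comp
    (ENNReal.summable (f := f)).hasSum
  exact le_of_tendsto ht (Filter.Eventually.of_forall fun t => (h t).trans (ENNReal.sum_le_tsum t))

/-- A dyadic majorant, up to the factor `2 ^ β`, of the kernel `d ^ (-β)` at scales below `ρ`:
`∑ᵢ (2⁻ⁱ ρ) ^ (-β)` over those `i` with `d < 2⁻ⁱ ρ`, where `ρ = 2 ^ u`. -/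
noncomputable def dyadicKernel (β u : ℝ) (d : ℝ≥0∞) : ℝ≥0∞ :=
  ∑' i : ℕ, if d < 2 ^ (u - i) then 2 ^ (-(β * (u - i))) else 0

lemma dyadicKernel_anti (β u : ℝ) {d e : ℝ≥0∞} (h : d ≤ e) :
    dyadicKernel β u e ≤ dyadicKernel β u d := by
  refine ENNReal.tsum_le_tsum fun i => ?_
  split_ifs with h1 h2
  · exact le_rfl
  · exact absurd (h.trans_lt h1) h2
  · exact zero_le
  · exact le_rfl

lemma rpow_neg_le_dyadicKernel {β u : ℝ} (hβ : 0 < β) {d : ℝ≥0∞} (hd : d < 2 ^ u) :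
    d ^ (-β) ≤ 2 ^ β * dyadicKernel β u d := by
  by_cases h0 : d = 0
  · -- all terms of the series are present, and they do not tend to zero
    have : dyadicKernel β u d = ∞ := by
      rw [← top_le_iff,
        ← ENNReal.tsum_const_eq_top_of_ne_zero (α := ℕ) (two_rpow_ne_zero (-(β * u)))]
      refine ENNReal.tsum_le_tsum fun i => ?_
      rw [if_pos (by rw [h0]; exact pos_iff_ne_zero.2 (two_rpow_ne_zero _))]
      refine two_rpow_mono ?_
      have : (0 : ℝ) ≤ i := i.cast_nonneg
      nlinarith
    rw [this, ENNReal.mul_top (two_rpow_ne_zero _)]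
    exact le_top
  have hex : ∃ i : ℕ, 2 ^ (u - (i + 1 : ℕ)) ≤ d ∧ d < 2 ^ (u - i) := by
    have hlim : ∃ i : ℕ, (2 : ℝ≥0∞) ^ (u - i) ≤ d := by
      have hd' : d * 2 ^ (-u) ≠ 0 := mul_ne_zero h0 (two_rpow_ne_zero _)
      obtain ⟨i, hi⟩ := ENNReal.exists_inv_two_pow_lt hd'
      refine ⟨i, ?_⟩
      have e : ((2 : ℝ≥0∞)⁻¹) ^ i = 2 ^ (-(i : ℝ)) := by
        rw [ENNReal.rpow_neg, ENNReal.rpow_natCast, ENNReal.inv_pow]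
      rw [e] at hi
      calc (2 : ℝ≥0∞) ^ (u - i) = 2 ^ (-(i : ℝ)) * 2 ^ u := by rw [two_rpow_mul]; congr 1; ring
        _ ≤ d * 2 ^ (-u) * 2 ^ u := by gcongr
        _ = d := by rw [mul_assoc, two_rpow_mul]; simp
    classical
    have hsp := Nat.find_spec hlim
    have hpos : Nat.find hlim ≠ 0 := by
      intro h
      rw [h] at hsp
      simp at hsp
      exact absurd hd (not_lt.2 hsp)
    refine ⟨Nat.find hlim - 1, ?_, ?_⟩
    · rwa [Nat.sub_add_cancel (Nat.pos_of_ne_zero hpos)]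
    · exact not_le.1 (Nat.find_min hlim (Nat.sub_lt (Nat.pos_of_ne_zero hpos) one_pos))
  obtain ⟨i, hi1, hi2⟩ := hex
  calc d ^ (-β) ≤ (2 ^ (u - (i + 1 : ℕ))) ^ (-β) := rpow_neg_anti hβ.le hi1
    _ = 2 ^ β * 2 ^ (-(β * (u - i))) := by
        rw [← ENNReal.rpow_mul, two_rpow_mul]
        congr 1; push_cast; ring
    _ ≤ 2 ^ β * dyadicKernel β u d := by
        gcongr
        refine le_trans ?_ (ENNReal.le_tsum i)
        rw [if_pos hi2]

lemma dyadicKernel_rpow_le {β u s : ℝ} (hs0 : 0 < s) (hs1 : s ≤ 1) (d : ℝ≥0∞) :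
    dyadicKernel β u d ^ s ≤ dyadicKernel (β * s) u d := by
  refine (tsum_rpow_le hs0 hs1 _).trans (ENNReal.tsum_le_tsum fun i => ?_)
  split_ifs
  · rw [← ENNReal.rpow_mul]
    exact two_rpow_mono (by linarith)
  · simp [hs0]

lemma mem_ball_coe_iff {n : ℕ} {y z : EuclideanSpace ℝ (Fin n)} {r : ℝ≥0} :
    y ∈ Metric.ball z (r : ℝ) ↔ edist y z < r := by
  rw [Metric.mem_ball, edist_nndist, ENNReal.coe_lt_coe, ← NNReal.coe_lt_coe, coe_nndist]

lemma isBallDominated_dyadicKernel {n : ℕ} {ν β : ℝ} (hβ : β < ν) :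
    ∃ C : ℝ≥0, ∀ (u : ℝ) (z : EuclideanSpace ℝ (Fin n)),
      IsBallDominated ν (fun y => dyadicKernel β u (edist y z)) (C * 2 ^ ((ν - β) * u)) := by
  obtain ⟨C, hC⟩ := exists_tsum_two_rpow_le (sub_pos.2 hβ)
  refine ⟨C, fun u z => ?_⟩
  have h2 : ∀ t : ℝ, (((2 : ℝ≥0) ^ t : ℝ≥0) : ℝ≥0∞) = 2 ^ t := fun t => by
    rw [ENNReal.coe_rpow_of_ne_zero two_ne_zero, ENNReal.coe_ofNat]
  refine (IsBallDominated.tsum fun i : ℕ =>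
    (IsBallDominated.ball ν z ((2 : ℝ≥0) ^ (u - i))).const_mul (2 ^ (-(β * (u - i))))).mono
      (fun y => ENNReal.tsum_le_tsum fun i => ?_) ?_
  · split_ifs with h
    · rw [Set.indicator_of_mem (by rwa [mem_ball_coe_iff, h2])]
      simp
    · exact zero_le
  · refine le_trans (le_of_eq ?_) (mul_le_mul_left hC _)
    rw [← ENNReal.tsum_mul_right]
    refine tsum_congr fun i => ?_
    rw [h2, ← ENNReal.rpow_mul, two_rpow_mul, two_rpow_mul]
    congr 1
    ring

/-- The potential of a set of content at most `ρ ^ ν` is at most a multiple of `ρ ^ (ν - β)`,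
where `ρ = 2 ^ u`. -/
lemma isBallDominated_indicator_mul_kernel {n : ℕ} {ν β : ℝ} (hβ0 : 0 < β) (hβ : β < ν) :
    ∃ C : ℝ≥0, ∀ (u : ℝ) (x : EuclideanSpace ℝ (Fin n)) (E : Set (EuclideanSpace ℝ (Fin n)))
      (z : ℕ → EuclideanSpace ℝ (Fin n)) (r : ℕ → ℝ≥0), (E ⊆ ⋃ i, Metric.ball (z i) (r i : ℝ)) →
      ∑' i, (r i : ℝ≥0∞) ^ ν ≤ 2 ^ (ν * u) →
      IsBallDominated ν (fun y => E.indicator 1 y * edist x y ^ (-β)) (C * 2 ^ ((ν - β) * u)) := by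
  obtain ⟨C, hC⟩ := isBallDominated_dyadicKernel (n := n) hβ
  refine ⟨(2 : ℝ≥0) ^ β * C + 1, fun u x E z r hE hr => ?_⟩
  refine (((hC u x).const_mul (2 ^ β)).add
    ((IsBallDominated.tsum fun i => IsBallDominated.ball ν (z i) (r i)).const_mul
      (2 ^ (-(β * u))))).mono (fun y => ?_) ?_
  · by_cases hy : y ∈ E
    · rw [Set.indicator_of_mem hy, Pi.one_apply, one_mul]
      by_cases hd : edist x y < 2 ^ u
      · refine le_add_right ?_
        rw [edist_comm y x]
        exact rpow_neg_le_dyadicKernel hβ0 hd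
      · refine le_add_left ?_
        obtain ⟨i, hi⟩ := Set.mem_iUnion.1 (hE hy)
        calc edist x y ^ (-β) ≤ (2 ^ u) ^ (-β) := rpow_neg_anti hβ0.le (not_lt.1 hd)
          _ = 2 ^ (-(β * u)) * (Metric.ball (z i) (r i : ℝ)).indicator 1 y := by
            rw [← ENNReal.rpow_mul, Set.indicator_of_mem hi, Pi.one_apply, mul_one]
            congr 1; ring
          _ ≤ _ := by
            gcongr
            exact ENNReal.le_tsum (f := fun i => (Metric.ball (z i) (r i : ℝ)).indicator
              (1 : EuclideanSpace ℝ (Fin n) → ℝ≥0∞) y) i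
    · simp [hy]
  · rw [ENNReal.coe_add, ENNReal.coe_mul, ENNReal.coe_rpow_of_ne_zero two_ne_zero,
      ENNReal.coe_ofNat, ENNReal.coe_one, add_mul, one_mul, mul_assoc]
    gcongr
    calc (2 : ℝ≥0∞) ^ (-(β * u)) * ∑' i, (r i : ℝ≥0∞) ^ ν
        ≤ 2 ^ (-(β * u)) * 2 ^ (ν * u) := by gcongr
      _ = _ := by rw [two_rpow_mul]; congr 1; ring

/-- The potential of a ball `B(z, r)` at `x` is at most a multiple of
`r ^ ν * max (dist x z) r ^ (-β)`. -/
lemma isBallDominated_ball_mul_kernel {n : ℕ} {ν β : ℝ} (hβ0 : 0 < β) (hβ : β < ν) :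
    ∃ C : ℝ≥0, ∀ (x z : EuclideanSpace ℝ (Fin n)) (r : ℝ≥0),
      IsBallDominated ν (fun y => (Metric.ball z (r : ℝ)).indicator 1 y * edist x y ^ (-β))
        (C * ((r : ℝ≥0∞) ^ ν * max (edist x z) r ^ (-β))) := by
  obtain ⟨C, hC⟩ := isBallDominated_dyadicKernel (n := n) hβ
  refine ⟨(2 : ℝ≥0) ^ β + (2 : ℝ≥0) ^ β * C * (3 ^ (ν - β) * 2 ^ β), fun x z r => ?_⟩
  have hhalf : ∀ t : ℝ≥0∞, (t / 2) ^ (-β) = 2 ^ β * t ^ (-β) := by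
    intro t
    rw [div_eq_mul_inv, ENNReal.rpow_neg, ENNReal.mul_rpow_of_nonneg _ _ hβ0.le,
      ENNReal.mul_inv (by simp [hβ0.le]) (by simp [hβ0.le]), ENNReal.inv_rpow, inv_inv,
      ENNReal.rpow_neg, mul_comm]
  have hcoe : (((2 : ℝ≥0) ^ β + (2 : ℝ≥0) ^ β * C * (3 ^ (ν - β) * 2 ^ β) : ℝ≥0) : ℝ≥0∞)
      = 2 ^ β + 2 ^ β * C * (3 ^ (ν - β) * 2 ^ β) := by
    push_cast
    rw [ENNReal.coe_rpow_of_ne_zero two_ne_zero, ENNReal.coe_rpow_of_ne_zero three_ne_zero,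
      ENNReal.coe_ofNat, ENNReal.coe_ofNat]
  rw [hcoe]
  by_cases hr : r = 0
  · refine ⟨0, fun y => ?_, ?_⟩ <;> simp [hr]
  have hr' : (r : ℝ≥0∞) ≠ 0 := by simpa using hr
  by_cases hd : edist x z < 2 * r
  · obtain ⟨u, hu⟩ := exists_two_rpow_eq (r := 3 * r) (mul_ne_zero three_ne_zero hr)
    refine ((hC u x).const_mul (2 ^ β)).mono (fun y => ?_) ?_
    · by_cases hy : y ∈ Metric.ball z (r : ℝ)
      · rw [Set.indicator_of_mem hy, Pi.one_apply, one_mul, edist_comm y x]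
        refine rpow_neg_le_dyadicKernel hβ0 ?_
        rw [mem_ball_coe_iff, edist_comm] at hy
        calc edist x y ≤ edist x z + edist z y := edist_triangle _ _ _
          _ < 2 * r + r := ENNReal.add_lt_add hd hy
          _ = 2 ^ u := by rw [hu]; push_cast; ring
      · simp [hy]
    · have hmax : (r : ℝ≥0∞) ^ (-β) ≤ 2 ^ β * max (edist x z) r ^ (-β) := by
        rw [← hhalf]
        refine rpow_neg_anti hβ0.le ?_
        rw [ENNReal.div_le_iff two_ne_zero ENNReal.ofNat_ne_top, mul_comm]
        exact max_le hd.le (le_mul_of_one_le_left' one_le_two)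
      calc (2 : ℝ≥0∞) ^ β * (C * 2 ^ ((ν - β) * u))
          = 2 ^ β * C * (3 ^ (ν - β) * (r ^ ν * r ^ (-β))) := by
            rw [mul_comm (ν - β) u, ENNReal.rpow_mul, hu, ENNReal.coe_mul,
              ENNReal.mul_rpow_of_nonneg _ _ (sub_pos.2 hβ).le, sub_eq_add_neg,
              ENNReal.rpow_add _ _ hr' ENNReal.coe_ne_top, ENNReal.coe_ofNat]
            ring
        _ ≤ 2 ^ β * C * (3 ^ (ν - β) * (r ^ ν * (2 ^ β * max (edist x z) r ^ (-β)))) := by gcongr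
        _ = 2 ^ β * C * (3 ^ (ν - β) * 2 ^ β) * (r ^ ν * max (edist x z) r ^ (-β)) := by ring
        _ ≤ _ := by gcongr; exact le_add_self
  · push Not at hd
    have hrd : (r : ℝ≥0∞) ≤ edist x z := (le_mul_of_one_le_left' one_le_two).trans hd
    rw [max_eq_left hrd]
    refine ((IsBallDominated.ball ν z r).const_mul (2 ^ β * edist x z ^ (-β))).mono
      (fun y => ?_) ?_
    · by_cases hy : y ∈ Metric.ball z (r : ℝ)
      · rw [Set.indicator_of_mem hy, Pi.one_apply, one_mul, mul_one, ← hhalf]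
        refine rpow_neg_anti hβ0.le ?_
        rw [mem_ball_coe_iff] at hy
        -- half of the distance to the centre remains after subtracting the radius
        have h1 : edist x z / 2 + r ≤ edist x y + r := by
          calc edist x z / 2 + r ≤ edist x z / 2 + edist x z / 2 := by
                gcongr
                rw [ENNReal.le_div_iff_mul_le (by simp) (by simp), mul_comm]
                exact hd
            _ = edist x z := ENNReal.add_halves _
            _ ≤ edist x y + edist y z := edist_triangle _ _ _
            _ ≤ edist x y + r := by gcongr
        exact (ENNReal.add_le_add_iff_right ENNReal.coe_ne_top).1 h1
      · simp [hy]
    · calc (2 : ℝ≥0∞) ^ β * edist x z ^ (-β) * r ^ ν = 2 ^ β * (r ^ ν * edist x z ^ (-β)) := by ring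
        _ ≤ _ := by gcongr; exact le_self_add

/-! ### Dyadic discretisation of integrals of decreasing functions -/

lemma ofReal_two_rpow (x : ℝ) : ENNReal.ofReal ((2 : ℝ) ^ x) = 2 ^ x := by
  rw [← ENNReal.ofReal_rpow_of_pos two_pos]
  simp

lemma lintegral_Ioi_le_tsum {φ : ℝ → ℝ≥0∞} (hφ : Antitone φ) {p : ℝ} (hp : 0 < p) (w : ℝ) :
    ∫⁻ t in Set.Ioi (0 : ℝ), φ t ≤ ∑' k : ℤ, 2 ^ (w + p * (k + 1)) * φ (2 ^ (w + p * k)) := by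
  have hsub : Set.Ioi (0 : ℝ) ⊆
      ⋃ k : ℤ, Set.Ioc ((2 : ℝ) ^ (w + p * k)) (2 ^ (w + p * (k + 1))) := by
    intro t ht
    have hpos : 0 < t / 2 ^ w := div_pos ht (by positivity)
    obtain ⟨k, hk1, hk2⟩ := exists_mem_Ioc_zpow hpos (Real.one_lt_rpow one_lt_two hp)
    have e : ∀ k : ℤ, ((2 : ℝ) ^ p) ^ k * 2 ^ w = 2 ^ (w + p * k) := fun k => by
      rw [← Real.rpow_intCast, ← Real.rpow_mul two_pos.le, ← Real.rpow_add two_pos, add_comm]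
    refine Set.mem_iUnion.2 ⟨k, ?_, ?_⟩
    · rw [← e]; exact (lt_div_iff₀ (by positivity)).1 hk1
    · have := e (k + 1)
      push_cast at this
      rw [← this]; exact (div_le_iff₀ (by positivity)).1 hk2
  refine (MeasureTheory.lintegral_mono_set hsub).trans <|
    (MeasureTheory.lintegral_iUnion_le _ _).trans <| ENNReal.tsum_le_tsum fun k => ?_
  calc ∫⁻ t in Set.Ioc ((2 : ℝ) ^ (w + p * k)) (2 ^ (w + p * (k + 1))), φ t
      ≤ ∫⁻ _ in Set.Ioc ((2 : ℝ) ^ (w + p * k)) (2 ^ (w + p * (k + 1))), φ (2 ^ (w + p * k)) :=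
        MeasureTheory.setLIntegral_mono' measurableSet_Ioc fun t ht => hφ ht.1.le
    _ ≤ _ := by
        rw [MeasureTheory.setLIntegral_const, Real.volume_Ioc, mul_comm, ← ofReal_two_rpow]
        gcongr
        exact sub_le_self _ (by positivity)

lemma tsum_le_lintegral_Ioi {p : ℝ} (hp : 0 < p) :
    ∃ C : ℝ≥0, ∀ φ : ℝ → ℝ≥0∞, Antitone φ →
      ∑' k : ℤ, 2 ^ (p * k) * φ (2 ^ (p * k)) ≤ C * ∫⁻ t in Set.Ioi (0 : ℝ), φ t := by
  have hlt : (2 : ℝ) ^ (-p) < 1 := Real.rpow_lt_one_of_one_lt_of_neg one_lt_two (by linarith)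
  set c : ℝ := 1 - 2 ^ (-p) with hc
  have hc0 : 0 < c := by linarith
  refine ⟨(c⁻¹).toNNReal, fun φ hφ => ?_⟩
  let ℓ : ℤ → ℝ := fun k => 2 ^ (p * (k - 1))
  have hmono : Monotone ℓ := fun a b hab => by
    have : (a : ℝ) ≤ b := by exact_mod_cast hab
    exact Real.rpow_le_rpow_of_exponent_le one_le_two (by nlinarith)
  have hdisj : Pairwise (Function.onFun Disjoint fun k => Set.Ioc (ℓ k) (ℓ (Order.succ k))) :=
    hmono.pairwise_disjoint_on_Ioc_succ
  have hsucc : ∀ k : ℤ, ℓ (Order.succ k) = 2 ^ (p * k) := fun k => by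
    simp [ℓ]
  calc ∑' k : ℤ, (2 : ℝ≥0∞) ^ (p * k) * φ (2 ^ (p * k))
      ≤ ∑' k : ℤ, ENNReal.ofReal c⁻¹ * ∫⁻ t in Set.Ioc (ℓ k) (ℓ (Order.succ k)), φ t := by
        refine ENNReal.tsum_le_tsum fun k => ?_
        calc (2 : ℝ≥0∞) ^ (p * k) * φ (2 ^ (p * k))
            = ENNReal.ofReal c⁻¹ *
                ∫⁻ _ in Set.Ioc (ℓ k) (ℓ (Order.succ k)), φ (2 ^ (p * k)) := by
              rw [MeasureTheory.setLIntegral_const, Real.volume_Ioc, mul_comm (φ _), ← mul_assoc,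
                ← ENNReal.ofReal_mul (by positivity), ← ofReal_two_rpow]
              congr 2
              have : ℓ k = 2 ^ (p * k) * 2 ^ (-p) := by
                rw [← Real.rpow_add two_pos]; simp only [ℓ]; congr 1; ring
              rw [hsucc, this, ← mul_one_sub, ← hc]
              field_simp
          _ ≤ _ := by
              refine mul_le_mul_right
                (MeasureTheory.setLIntegral_mono' measurableSet_Ioc fun t ht => hφ ?_) _
              rw [← hsucc]; exact ht.2
    _ = ENNReal.ofReal c⁻¹ * ∫⁻ t in ⋃ k, Set.Ioc (ℓ k) (ℓ (Order.succ k)), φ t := by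
        rw [ENNReal.tsum_mul_left, 
          MeasureTheory.lintegral_iUnion (fun k => measurableSet_Ioc (a := ℓ k)) hdisj]
    _ ≤ _ := by
        refine mul_le_mul_right (MeasureTheory.lintegral_mono_set ?_) _
        refine Set.iUnion_subset fun k t ht => lt_trans ?_ ht.1
        simp only [ℓ]; positivity

/-! ### Level sets and their covers -/

lemma antitone_content_superlevel {n : ℕ} (δ : ℝ) (g : EuclideanSpace ℝ (Fin n) → ℝ≥0∞) :
    Antitone fun t : ℝ => hausdorffContent δ {x ∈ Set.univ | ENNReal.ofReal t < g x} :=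
  fun _ _ hst => hausdorffContent_mono δ fun _ hx =>
    ⟨trivial, (ENNReal.ofReal_le_ofReal hst).trans_lt hx.2⟩

lemma superlevel_rpow_eq {X : Type*} (F : X → ℝ≥0∞) {p : ℝ} (hp : 0 < p) (y : ℝ) :
    {x ∈ Set.univ | ENNReal.ofReal ((2 : ℝ) ^ (p * y)) < F x ^ p} = {x | 2 ^ y < F x} := by
  ext x
  rw [ofReal_two_rpow, mul_comm p y, ENNReal.rpow_mul]
  simp [ENNReal.rpow_lt_rpow_iff hp]

/-- A function is at most the sum of `2 ^ (k + 1)` over its superlevel sets at height `2 ^ k`. -/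
lemma le_tsum_superlevel {X : Type*} (F : X → ℝ≥0∞) (y : X) :
    F y ≤ ∑' k : ℤ, 2 ^ ((k : ℝ) + 1) * {x | 2 ^ (k : ℝ) < F x}.indicator 1 y := by
  by_cases h0 : F y = 0
  · rw [h0]; exact zero_le
  by_cases ht : F y = ∞
  · refine le_trans le_top ?_
    rw [← ENNReal.tsum_const_eq_top_of_ne_zero (α := ℕ) one_ne_zero]
    refine le_trans (ENNReal.tsum_le_tsum fun i => ?_)
      (ENNReal.tsum_comp_le_tsum_of_injective (f := fun i : ℕ => (i : ℤ))
        (fun a b h => by simpa using h) _)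
    rw [Set.indicator_of_mem (by simp [ht])]
    simp only [Pi.one_apply, mul_one, Int.cast_natCast]
    exact ENNReal.one_le_rpow one_le_two (by positivity)
  obtain ⟨k, hk1, hk2⟩ := ENNReal.exists_mem_Ioc_zpow h0 ht ENNReal.one_lt_two ENNReal.ofNat_ne_top
  refine le_trans ?_ (ENNReal.le_tsum k)
  rw [← ENNReal.rpow_intCast] at hk1 hk2
  rw [Set.indicator_of_mem (by exact hk1)]
  simpa using hk2

/-- Covers of all superlevel sets whose total cost is controlled by the Choquet integral. -/
lemma exists_superlevel_covers {n : ℕ} {δ p : ℝ} (hp : 0 < p) :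
    ∃ C : ℝ≥0, ∀ (F : EuclideanSpace ℝ (Fin n) → ℝ≥0∞) (A : ℝ≥0∞),
      C * choquetIntegral (hausdorffContent δ) Set.univ (fun x => F x ^ p) < A →
      ∃ (z : ℤ → ℕ → EuclideanSpace ℝ (Fin n)) (r : ℤ → ℕ → ℝ≥0),
        (∀ k : ℤ, {x | 2 ^ (k : ℝ) < F x} ⊆ ⋃ i, Metric.ball (z k i) (r k i : ℝ)) ∧
        ∑' k : ℤ, 2 ^ (p * k) * ∑' i, (r k i : ℝ≥0∞) ^ δ ≤ A := by
  obtain ⟨C, hC⟩ := tsum_le_lintegral_Ioi hp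
  refine ⟨C, fun F A hA => ?_⟩
  have h1 := (hC _ (antitone_content_superlevel δ fun x => F x ^ p)).trans_lt hA
  simp_rw [superlevel_rpow_eq F hp] at h1
  obtain ⟨ε, hε0, hε⟩ := ENNReal.exists_pos_sum_of_countable' (tsub_pos_of_lt h1).ne' ℤ
  have hcov : ∀ k : ℤ, ∃ (z : ℕ → EuclideanSpace ℝ (Fin n)) (r : ℕ → ℝ≥0),
      ({x | 2 ^ (k : ℝ) < F x} ⊆ ⋃ i, Metric.ball (z i) (r i : ℝ)) ∧
      ∑' i, (r i : ℝ≥0∞) ^ δ <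
        hausdorffContent δ {x | 2 ^ (k : ℝ) < F x} + 2 ^ (-(p * k)) * ε k := by
    intro k
    have hfin : hausdorffContent δ {x | 2 ^ (k : ℝ) < F x} ≠ ∞ := by
      intro htop
      have := (ENNReal.le_tsum (f := fun k : ℤ =>
        2 ^ (p * k) * hausdorffContent δ {x | 2 ^ (k : ℝ) < F x}) k).trans_lt h1
      rw [htop, ENNReal.mul_top (two_rpow_ne_zero _)] at this
      exact not_top_lt this
    have hlt : hausdorffContent δ {x | 2 ^ (k : ℝ) < F x}
        < hausdorffContent δ {x | 2 ^ (k : ℝ) < F x} + 2 ^ (-(p * k)) * ε k :=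
      ENNReal.lt_add_right hfin (mul_ne_zero (two_rpow_ne_zero _) (hε0 k).ne')
    conv_lhs at hlt => rw [hausdorffContent]
    simp only [iInf_lt_iff] at hlt
    obtain ⟨z, r, hzr, hlt⟩ := hlt
    exact ⟨z, r, hzr, hlt⟩
  choose z r hzr hlt using hcov
  refine ⟨z, r, hzr, ?_⟩
  calc ∑' k : ℤ, 2 ^ (p * k) * ∑' i, (r k i : ℝ≥0∞) ^ δ
      ≤ ∑' k : ℤ, (2 ^ (p * k) * hausdorffContent δ {x | 2 ^ (k : ℝ) < F x} + ε k) := by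
        refine ENNReal.tsum_le_tsum fun k => (mul_le_mul_right (hlt k).le _).trans (le_of_eq ?_)
        rw [mul_add, ← mul_assoc, two_rpow_mul]
        simp
    _ ≤ A := by
        rw [ENNReal.tsum_add]
        calc _ ≤ _ + (A - _) := add_le_add_right hε.le _
          _ = A := add_tsub_cancel_of_le h1.le

/-! ### The potential of a superposition of balls -/

/-- A majorant, up to constants, of the part of the potential that the balls `B(z k i, r k i)`,
`k ≥ m`, taken with weight `2 ^ k`, produce at points at distance less than `2 ^ u` from their
centres: the kernel `d ^ (-β)` is replaced by its dyadic majorant cut at `2 ^ u`, and a ball by its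
volume `r ^ n`. -/
noncomputable def localPotential {n : ℕ} (β u : ℝ) (z : ℤ → ℕ → EuclideanSpace ℝ (Fin n))
    (r : ℤ → ℕ → ℝ≥0) (m : ℤ) (x : EuclideanSpace ℝ (Fin n)) : ℝ≥0∞ :=
  ∑' k : ℤ, if m ≤ k then
    2 ^ (k : ℝ) * ∑' i, (r k i : ℝ≥0∞) ^ (n : ℝ) * dyadicKernel β u (edist x (z k i)) else 0

lemma tsum_rpow_le_of_tsum_rpow_le {δ ν u : ℝ} (hδ : 0 < δ) (hν : δ ≤ ν) {ι : Type*} (r : ι → ℝ≥0∞)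
    (h : ∑' i, r i ^ δ ≤ 2 ^ (δ * u)) : ∑' i, r i ^ ν ≤ 2 ^ (ν * u) := by
  have hν0 : 0 < ν := hδ.trans_le hν
  have hs : 0 < δ / ν := div_pos hδ hν0
  rw [← ENNReal.rpow_le_rpow_iff hs]
  refine (tsum_rpow_le hs ((div_le_one hν0).2 hν) _).trans ?_
  simp_rw [← ENNReal.rpow_mul]
  rw [mul_div_cancel₀ _ hν0.ne', show ν * u * (δ / ν) = δ * u by field_simp]
  exact h

/-- Pointwise bound for the potential of `F`, given covers of its superlevel sets with
`∑ₖ 2 ^ (p k) ∑ᵢ r k i ^ δ ≤ 2 ^ (δ τ)`. Levels below `m` are estimated by the measure of the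
superlevel sets, levels above `m` by the potentials of the covering balls, cut at the radius
`2 ^ (τ - p m / δ)`. -/
lemma exists_potential_le {n : ℕ} {δ α p : ℝ} (hδ0 : 0 < δ) (hδn : δ ≤ n) (hα0 : 0 < α)
    (hαδ : α < δ) (hp1 : δ / n < p) (hp2 : p < δ / α) :
    ∃ C : ℝ≥0, ∀ (τ : ℝ) (F : EuclideanSpace ℝ (Fin n) → ℝ≥0∞)
      (z : ℤ → ℕ → EuclideanSpace ℝ (Fin n)) (r : ℤ → ℕ → ℝ≥0),
      (∀ k : ℤ, {x | 2 ^ (k : ℝ) < F x} ⊆ ⋃ i, Metric.ball (z k i) (r k i : ℝ)) →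
      ∑' k : ℤ, 2 ^ (p * k) * ∑' i, (r k i : ℝ≥0∞) ^ δ ≤ 2 ^ (δ * τ) → ∀ (m : ℤ) x,
      choquetIntegral (hausdorffContent n) Set.univ (fun y => F y * edist x y ^ (-(n - α)))
        ≤ C * (2 ^ (m + α * (τ - p * m / δ)) +
            localPotential (n - α) (τ - p * m / δ) z r m x) := by
  have hn0 : (0 : ℝ) < n := hδ0.trans_le hδn
  have hβ0 : 0 < n - α := by linarith
  have hβn : n - α < n := by linarith
  have hθ1 : 0 < 1 - α * p / δ := by
    rw [sub_pos, div_lt_one hδ0]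
    rw [lt_div_iff₀ hα0] at hp2
    linarith
  have hθ2 : 0 < n * p / δ - 1 := by
    rw [sub_pos, one_lt_div hδ0]
    rw [div_lt_iff₀ hn0] at hp1
    linarith
  obtain ⟨CH, hCH⟩ := IsBallDominated.choquetIntegral_le (n := n) hn0
  obtain ⟨CU, hCU⟩ := isBallDominated_indicator_mul_kernel (n := n) hβ0 hβn
  obtain ⟨CV, hCV⟩ := isBallDominated_ball_mul_kernel (n := n) hβ0 hβn
  obtain ⟨G1, hG1⟩ := exists_tsum_int_le hθ1
  obtain ⟨G2, hG2⟩ := exists_tsum_int_le' hθ2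
  refine ⟨CH * (2 * CU * G1 + 2 * CV * G2 + 2 * CV * 2 ^ (n - α)), fun τ F z r hcov hA m x => ?_⟩
  have hSδ : ∀ k : ℤ, ∑' i, (r k i : ℝ≥0∞) ^ δ ≤ 2 ^ (δ * (τ - p * k / δ)) := by
    intro k
    have h1 := (ENNReal.le_tsum
      (f := fun k : ℤ => 2 ^ (p * k) * ∑' i, (r k i : ℝ≥0∞) ^ δ) k).trans hA
    calc ∑' i, (r k i : ℝ≥0∞) ^ δ
        = 2 ^ (-(p * k)) * (2 ^ (p * k) * ∑' i, (r k i : ℝ≥0∞) ^ δ) := by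
          rw [← mul_assoc, two_rpow_mul]; simp
      _ ≤ 2 ^ (-(p * k)) * 2 ^ (δ * τ) := by gcongr
      _ = _ := by
          rw [two_rpow_mul]; congr 1; field_simp; ring
  have hSn : ∀ k : ℤ, ∑' i, (r k i : ℝ≥0∞) ^ (n : ℝ) ≤ 2 ^ (n * (τ - p * k / δ)) := fun k =>
    tsum_rpow_le_of_tsum_rpow_le hδ0 hδn _ (hSδ k)
  set u : ℝ := τ - p * m / δ with hu
  have hdom : IsBallDominated (n : ℝ) (fun y => F y * edist x y ^ (-(n - α)))
      (∑' k : ℤ, if m ≤ k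
        then 2 ^ ((k : ℝ) + 1) * ∑' i, CV * ((r k i : ℝ≥0∞) ^ (n : ℝ) *
          max (edist x (z k i)) (r k i) ^ (-(n - α)))
        else 2 ^ ((k : ℝ) + 1) * ((CU : ℝ≥0∞) * 2 ^ ((n - (n - α)) * (τ - p * k / δ)))) := by
    refine (IsBallDominated.tsum (G := fun (k : ℤ) y => 2 ^ ((k : ℝ) + 1) *
      ({x | 2 ^ (k : ℝ) < F x}.indicator 1 y * edist x y ^ (-(n - α)))) fun k => ?_).mono
      (fun y => ?_) le_rfl
    · split_ifs with hk
      · refine IsBallDominated.const_mul ?_ _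
        refine (IsBallDominated.tsum fun i => hCV x (z k i) (r k i)).mono (fun y => ?_) le_rfl
        rw [ENNReal.tsum_mul_right]
        gcongr
        by_cases hy : 2 ^ (k : ℝ) < F y
        · obtain ⟨i, hi⟩ := Set.mem_iUnion.1 (hcov k hy)
          refine le_trans ?_ (ENNReal.le_tsum i)
          rw [Set.indicator_of_mem hi]
          exact Set.indicator_le_self' (fun _ _ => zero_le) _
        · rw [Set.indicator_of_notMem (by exact hy)]
          exact zero_le
      · exact IsBallDominated.const_mul (hCU _ x _ (z k) (r k) (hcov k) (hSn k)) _
    · simp_rw [← mul_assoc, ENNReal.tsum_mul_right]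
      gcongr
      exact le_tsum_superlevel F y
  refine (hCH _ _ hdom).trans ?_
  rw [ENNReal.coe_mul, mul_assoc]
  gcongr
  -- bound for the levels below `m`
  have hlow : (∑' k : ℤ, if k ≤ m then
      2 ^ ((k : ℝ) + 1) * ((CU : ℝ≥0∞) * 2 ^ ((n - (n - α)) * (τ - p * k / δ))) else 0)
      ≤ 2 * CU * G1 * 2 ^ (m + α * u) := by
    calc (∑' k : ℤ, if k ≤ m then
          2 ^ ((k : ℝ) + 1) * ((CU : ℝ≥0∞) * 2 ^ ((n - (n - α)) * (τ - p * k / δ))) else 0)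
        = ∑' k : ℤ, (2 * CU * 2 ^ (α * τ)) *
            (if k ≤ m then (2 : ℝ≥0∞) ^ ((1 - α * p / δ) * k) else 0) := by
          refine tsum_congr fun k => ?_
          split_ifs
          · calc (2 : ℝ≥0∞) ^ ((k : ℝ) + 1) * (CU * 2 ^ ((n - (n - α)) * (τ - p * k / δ)))
                = CU * (2 ^ ((k : ℝ) + 1) * 2 ^ ((n - (n - α)) * (τ - p * k / δ))) := by ring
              _ = CU * (2 ^ (1 : ℝ) * (2 ^ (α * τ) * 2 ^ ((1 - α * p / δ) * k))) := by
                simp only [two_rpow_mul]; congr 2; field_simp; ring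
              _ = _ := by rw [ENNReal.rpow_one]; ring
          · simp
      _ ≤ (2 * CU * 2 ^ (α * τ)) * (G1 * 2 ^ ((1 - α * p / δ) * m)) := by
          rw [ENNReal.tsum_mul_left]
          gcongr
          exact hG1 m
      _ = 2 * CU * G1 * (2 ^ (α * τ) * 2 ^ ((1 - α * p / δ) * m)) := by ring
      _ = _ := by
          rw [two_rpow_mul]; congr 2; rw [hu]; field_simp; ring
  -- the tails of the potentials of the balls at levels at least `m`
  have htail : (∑' k : ℤ, if m ≤ k then
      2 ^ ((k : ℝ) + 1) *
              ((CV : ℝ≥0∞) * (2 ^ (-((n - α) * u)) * 2 ^ (n * (τ - p * k / δ)))) else 0)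
      ≤ 2 * CV * G2 * 2 ^ (m + α * u) := by
    calc (∑' k : ℤ, if m ≤ k then
          2 ^ ((k : ℝ) + 1) *
              ((CV : ℝ≥0∞) * (2 ^ (-((n - α) * u)) * 2 ^ (n * (τ - p * k / δ)))) else 0)
        = ∑' k : ℤ, (2 * CV * 2 ^ (n * τ - (n - α) * u)) *
            (if m ≤ k then (2 : ℝ≥0∞) ^ (-((n * p / δ - 1) * k)) else 0) := by
          refine tsum_congr fun k => ?_
          split_ifs
          · calc (2 : ℝ≥0∞) ^ ((k : ℝ) + 1) *
                  (CV * (2 ^ (-((n - α) * u)) * 2 ^ (n * (τ - p * k / δ))))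
                = CV * (2 ^ ((k : ℝ) + 1) *
                    (2 ^ (-((n - α) * u)) * 2 ^ (n * (τ - p * k / δ)))) := by
                  ring
              _ = CV * (2 ^ (1 : ℝ) * (2 ^ (n * τ - (n - α) * u) *
                    2 ^ (-((n * p / δ - 1) * k)))) := by
                simp only [two_rpow_mul]; congr 2; field_simp; ring
              _ = _ := by rw [ENNReal.rpow_one]; ring
          · simp
      _ ≤ (2 * CV * 2 ^ (n * τ - (n - α) * u)) * (G2 * 2 ^ (-((n * p / δ - 1) * m))) := by
          rw [ENNReal.tsum_mul_left]
          gcongr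
          exact hG2 m
      _ = 2 * CV * G2 * (2 ^ (n * τ - (n - α) * u) * 2 ^ (-((n * p / δ - 1) * m))) := by ring
      _ = _ := by
          rw [two_rpow_mul]; congr 2; rw [hu]; field_simp; ring
  -- the potential of a ball, cut at distance `2 ^ u` from its centre
  have hmax : ∀ (d ρ : ℝ≥0∞), max d ρ ^ (-(n - α))
      ≤ 2 ^ (-((n - α) * u)) + 2 ^ (n - α) * dyadicKernel (n - α) u d := by
    intro d ρ
    by_cases h : max d ρ < 2 ^ u
    · refine le_add_left ((rpow_neg_le_dyadicKernel hβ0 h).trans ?_)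
      gcongr
      exact dyadicKernel_anti _ _ (le_max_left _ _)
    · refine le_add_right ((rpow_neg_anti hβ0.le (not_lt.1 h)).trans (le_of_eq ?_))
      rw [← ENNReal.rpow_mul]; congr 1; ring
  have hup : ∀ k : ℤ, ∑' i, CV * ((r k i : ℝ≥0∞) ^ (n : ℝ) *
          max (edist x (z k i)) (r k i) ^ (-(n - α)))
      ≤ CV * (2 ^ (-((n - α) * u)) * 2 ^ (n * (τ - p * k / δ))) +
        CV * 2 ^ (n - α) *
          ∑' i, (r k i : ℝ≥0∞) ^ (n : ℝ) * dyadicKernel (n - α) u (edist x (z k i)) := by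
    intro k
    calc _ ≤ ∑' i, (CV * (2 ^ (-((n - α) * u)) * (r k i : ℝ≥0∞) ^ (n : ℝ)) +
          CV * 2 ^ (n - α) *
            ((r k i : ℝ≥0∞) ^ (n : ℝ) * dyadicKernel (n - α) u (edist x (z k i)))) := by
          refine ENNReal.tsum_le_tsum fun i => ?_
          calc (CV : ℝ≥0∞) * ((r k i : ℝ≥0∞) ^ (n : ℝ) *
                max (edist x (z k i)) (r k i) ^ (-(n - α)))
              ≤ CV * ((r k i : ℝ≥0∞) ^ (n : ℝ) *
                (2 ^ (-((n - α) * u)) +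
                  2 ^ (n - α) * dyadicKernel (n - α) u (edist x (z k i)))) := by
                gcongr; exact hmax _ _
            _ = _ := by ring
      _ ≤ _ := by
          rw [ENNReal.tsum_add, ENNReal.tsum_mul_left, ENNReal.tsum_mul_left,
            ENNReal.tsum_mul_left]
          gcongr
          exact hSn k
  calc _ ≤ ∑' k : ℤ, ((if k ≤ m then
            2 ^ ((k : ℝ) + 1) * ((CU : ℝ≥0∞) * 2 ^ ((n - (n - α)) * (τ - p * k / δ))) else 0) +
          (if m ≤ k then
            2 ^ ((k : ℝ) + 1) *
              ((CV : ℝ≥0∞) * (2 ^ (-((n - α) * u)) * 2 ^ (n * (τ - p * k / δ)))) else 0) +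
          2 * CV * 2 ^ (n - α) * (if m ≤ k then 2 ^ (k : ℝ) *
            ∑' i, (r k i : ℝ≥0∞) ^ (n : ℝ) * dyadicKernel (n - α) u (edist x (z k i)) else 0)) := by
        refine ENNReal.tsum_le_tsum fun k => ?_
        by_cases hk : m ≤ k
        · simp only [if_pos hk]
          refine (mul_le_mul_right (hup k) _).trans ?_
          rw [add_assoc]
          refine le_add_left (le_of_eq ?_)
          rw [← two_rpow_mul, ENNReal.rpow_one]
          ring
        · simp only [if_neg hk]
          rw [if_pos (by omega), add_assoc]
          exact le_self_add
    _ ≤ 2 * CU * G1 * 2 ^ (m + α * u) + 2 * CV * G2 * 2 ^ (m + α * u) +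
          2 * CV * 2 ^ (n - α) * localPotential (n - α) u z r m x := by
        rw [ENNReal.tsum_add, ENNReal.tsum_add, ENNReal.tsum_mul_left]
        gcongr
        exact le_rfl
    _ ≤ (2 * CU * G1 + 2 * CV * G2 + 2 * CV * 2 ^ (n - α)) *
          (2 ^ (m + α * u) + localPotential (n - α) u z r m x) := by
        rw [mul_add]
        refine add_le_add ?_ ?_
        · rw [← add_mul]
          exact mul_le_mul_left le_self_add _
        · exact mul_le_mul_left le_add_self _
    _ = _ := by
        push_cast
        rw [ENNReal.coe_rpow_of_ne_zero two_ne_zero, ENNReal.coe_ofNat]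

/-- The estimate of weak type at the exponent `s = δ / n`, which is at most one, so that
`s`-th powers of sums of potentials of balls may be taken termwise. -/
lemma exists_content_localPotential_le {n : ℕ} {δ α : ℝ} (hδ0 : 0 < δ) (hδn : δ ≤ n)
    (hα0 : 0 < α) :
    ∃ C : ℝ≥0, ∀ (u : ℝ) (z : ℤ → ℕ → EuclideanSpace ℝ (Fin n)) (r : ℤ → ℕ → ℝ≥0) (m : ℤ),
      2 ^ (δ / n * m) *
          hausdorffContent δ {x | 2 ^ (m + α * u) < localPotential (n - α) u z r m x}
        ≤ C * ∑' k : ℤ, if m ≤ k then 2 ^ (δ / n * k) * ∑' i, (r k i : ℝ≥0∞) ^ δ else 0 := by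
  have hn0 : (0 : ℝ) < n := hδ0.trans_le hδn
  set s : ℝ := δ / n with hs
  have hs0 : 0 < s := div_pos hδ0 hn0
  have hs1 : s ≤ 1 := (div_le_one hn0).2 hδn
  have hns : n * s = δ := by rw [hs]; field_simp
  have hβ : (n - α) * s < δ := by nlinarith
  have hexp : δ - (n - α) * s = s * α := by rw [← hns]; ring
  obtain ⟨CK, hCK⟩ := isBallDominated_dyadicKernel (n := n) hβ
  obtain ⟨CH, hCH⟩ := IsBallDominated.hausdorffContent_le (n := n) hδ0
  refine ⟨CH * CK, fun u z r m => ?_⟩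
  set S : ℝ≥0∞ := ∑' k : ℤ, if m ≤ k then 2 ^ (s * k) * ∑' i, (r k i : ℝ≥0∞) ^ δ else 0 with hS
  have hdom : IsBallDominated δ (fun x => localPotential (n - α) u z r m x ^ s)
      (CK * 2 ^ (s * α * u) * S) := by
    refine (IsBallDominated.tsum (G := fun (k : ℤ) x => if m ≤ k then 2 ^ (s * k) *
        ∑' i, (r k i : ℝ≥0∞) ^ δ * dyadicKernel ((n - α) * s) u (edist x (z k i)) else 0)
      (B := fun k => CK * 2 ^ (s * α * u) *
        (if m ≤ k then 2 ^ (s * k) * ∑' i, (r k i : ℝ≥0∞) ^ δ else 0)) fun k => ?_).mono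
      (fun x => ?_) (ENNReal.tsum_mul_left).le
    · split_ifs
      · refine (IsBallDominated.const_mul (IsBallDominated.tsum fun i =>
          (hCK u (z k i)).const_mul ((r k i : ℝ≥0∞) ^ δ)) (2 ^ (s * k))).mono (fun _ => le_rfl)
          (le_of_eq ?_)
        rw [ENNReal.tsum_mul_right, hexp]
        ring
      · exact ⟨0, by simp, by simp⟩
    · refine (tsum_rpow_le hs0 hs1 _).trans (ENNReal.tsum_le_tsum fun k => ?_)
      split_ifs
      · rw [ENNReal.mul_rpow_of_nonneg _ _ hs0.le, ← ENNReal.rpow_mul, mul_comm (k : ℝ) s]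
        gcongr
        refine (tsum_rpow_le hs0 hs1 _).trans (ENNReal.tsum_le_tsum fun i => ?_)
        rw [ENNReal.mul_rpow_of_nonneg _ _ hs0.le, ← ENNReal.rpow_mul, hns]
        gcongr
        exact dyadicKernel_rpow_le hs0 hs1 _
      · simp [hs0]
  have h1 := hCH _ _ hdom (2 ^ ((m + α * u) * s)) (two_rpow_ne_top _)
  have hset : {x | (2 : ℝ≥0∞) ^ ((m + α * u) * s) < localPotential (n - α) u z r m x ^ s}
      = {x | (2 : ℝ≥0∞) ^ (m + α * u) < localPotential (n - α) u z r m x} := by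
    ext x
    rw [Set.mem_ofPred_eq, Set.mem_ofPred_eq, ENNReal.rpow_mul, ENNReal.rpow_lt_rpow_iff hs0]
  rw [hset] at h1
  set H := hausdorffContent δ {x | (2 : ℝ≥0∞) ^ (m + α * u) < localPotential (n - α) u z r m x}
  calc (2 : ℝ≥0∞) ^ (s * m) * H = 2 ^ (-(s * α * u)) * (2 ^ ((m + α * u) * s) * H) := by
        rw [← mul_assoc, two_rpow_mul]; congr 2; ring
    _ ≤ 2 ^ (-(s * α * u)) * (CH * (CK * 2 ^ (s * α * u) * S)) := by gcongr
    _ = (2 ^ (-(s * α * u)) * 2 ^ (s * α * u)) * (CH * CK * S) := by ring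
    _ = _ := by rw [two_rpow_mul]; simp

/-! ### The potential estimate -/

/-- Interpolation: the estimates of the content of the superlevel sets of the potential at heights
comparable to `2 ^ (m + α (τ - p m / δ))` are summed over all `m`. -/
lemma exists_choquetIntegral_potential_le {n : ℕ} {δ α p : ℝ} (hδ0 : 0 < δ) (hδn : δ ≤ n)
    (hα0 : 0 < α) (hαδ : α < δ) (hp1 : δ / n < p) (hp2 : p < δ / α) :
    ∃ C : ℝ≥0, ∀ (τ : ℝ) (F : EuclideanSpace ℝ (Fin n) → ℝ≥0∞)
      (z : ℤ → ℕ → EuclideanSpace ℝ (Fin n)) (r : ℤ → ℕ → ℝ≥0),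
      (∀ k : ℤ, {x | 2 ^ (k : ℝ) < F x} ⊆ ⋃ i, Metric.ball (z k i) (r k i : ℝ)) →
      ∑' k : ℤ, 2 ^ (p * k) * ∑' i, (r k i : ℝ≥0∞) ^ δ ≤ 2 ^ (δ * τ) →
      choquetIntegral (hausdorffContent δ) Set.univ (fun x =>
          choquetIntegral (hausdorffContent n) Set.univ
            (fun y => F y * edist x y ^ (-(n - α))) ^ (δ * p / (δ - p * α)))
        ≤ C * (2 ^ (δ * τ)) ^ (δ / (δ - p * α)) := by
  have hn0 : (0 : ℝ) < n := hδ0.trans_le hδn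
  have hp0 : 0 < p := (div_pos hδ0 hn0).trans hp1
  have hpα : 0 < δ - p * α := by
    rw [lt_div_iff₀ hα0] at hp2
    linarith
  set q : ℝ := δ * p / (δ - p * α) with hq
  have hq0 : 0 < q := div_pos (mul_pos hδ0 hp0) hpα
  set s : ℝ := δ / n with hs
  have hθ : 0 < p - s := sub_pos.2 hp1
  obtain ⟨C1, hC1⟩ := exists_potential_le hδ0 hδn hα0 hαδ hp1 hp2
  obtain ⟨C2, hC2⟩ := exists_content_localPotential_le hδ0 hδn hα0
  obtain ⟨G, hG⟩ := exists_tsum_int_le hθ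
  obtain ⟨κ, hκ⟩ := exists_two_rpow_eq (r := 2 * (C1 + 1)) (by positivity)
  refine ⟨(2 : ℝ≥0) ^ (q * κ + p) * C2 * G, fun τ F z r hcov hA => ?_⟩
  set R : EuclideanSpace ℝ (Fin n) → ℝ≥0∞ := fun x =>
    choquetIntegral (hausdorffContent n) Set.univ (fun y => F y * edist x y ^ (-(n - α))) with hR
  set S : ℤ → ℝ≥0∞ := fun k => ∑' i, (r k i : ℝ≥0∞) ^ δ with hS
  set w : ℝ := q * (κ + α * τ) with hw
  -- the `q`-th powers of these heights form a geometric progression with ratio `2 ^ p`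
  have hlevel : ∀ m : ℤ, w + p * m = q * (κ + (m + α * (τ - p * m / δ))) := by
    intro m
    have : q * (1 - α * p / δ) = p := by
      rw [hq]; field_simp
    rw [hw]
    linear_combination (-(m : ℝ)) * this
  have hcontent : ∀ m : ℤ,
      hausdorffContent δ {x ∈ Set.univ | ENNReal.ofReal ((2 : ℝ) ^ (w + p * m)) < R x ^ q}
        ≤ 2 ^ (-(s * m)) * (C2 * ∑' k : ℤ, if m ≤ k then 2 ^ (s * k) * S k else 0) := by
    intro m
    rw [hlevel, superlevel_rpow_eq R hq0]
    refine le_trans ?_ (mul_le_mul_right (hC2 (τ - p * m / δ) z r m) _)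
    rw [← mul_assoc, two_rpow_mul, neg_add_cancel, ENNReal.rpow_zero, one_mul]
    refine hausdorffContent_mono δ fun x hx => ?_
    rw [Set.mem_ofPred_eq] at hx ⊢
    by_contra hcon
    refine absurd hx (not_lt.2 ((hC1 τ F z r hcov hA m x).trans ?_))
    rw [← two_rpow_mul κ, hκ]
    push_cast
    calc (C1 : ℝ≥0∞) * (2 ^ (m + α * (τ - p * m / δ)) +
          localPotential (n - α) (τ - p * m / δ) z r m x)
        ≤ (C1 + 1) * (2 ^ (m + α * (τ - p * m / δ)) + 2 ^ (m + α * (τ - p * m / δ))) := by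
          gcongr
          · exact le_self_add
          · exact not_lt.1 hcon
      _ = _ := by ring
  calc choquetIntegral (hausdorffContent δ) Set.univ (fun x => R x ^ q)
      ≤ ∑' m : ℤ, 2 ^ (w + p * (m + 1)) *
          hausdorffContent δ {x ∈ Set.univ | ENNReal.ofReal ((2 : ℝ) ^ (w + p * m)) < R x ^ q} :=
        lintegral_Ioi_le_tsum (antitone_content_superlevel δ fun x => R x ^ q) hp0 w
    _ ≤ ∑' m : ℤ, 2 ^ (w + p * (m + 1)) *
          (2 ^ (-(s * m)) * (C2 * ∑' k : ℤ, if m ≤ k then 2 ^ (s * k) * S k else 0)) :=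
        ENNReal.tsum_le_tsum fun m => mul_le_mul_right (hcontent m) _
    _ = ∑' m : ℤ, ∑' k : ℤ, 2 ^ (w + p) * C2 *
          (2 ^ (s * k) * S k * (if m ≤ k then 2 ^ ((p - s) * m) else 0)) := by
        refine tsum_congr fun m => ?_
        rw [← ENNReal.tsum_mul_left, ← ENNReal.tsum_mul_left, ← ENNReal.tsum_mul_left]
        refine tsum_congr fun k => ?_
        split_ifs
        · calc (2 : ℝ≥0∞) ^ (w + p * (m + 1)) * (2 ^ (-(s * m)) * (C2 * (2 ^ (s * k) * S k)))
              = (2 ^ (w + p * (m + 1)) * 2 ^ (-(s * m))) * (C2 * (2 ^ (s * k) * S k)) := by ring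
            _ = (2 ^ (w + p) * 2 ^ ((p - s) * m)) * (C2 * (2 ^ (s * k) * S k)) := by
              rw [two_rpow_mul, two_rpow_mul]; congr 2; ring
            _ = _ := by ring
        · simp
    _ = 2 ^ (w + p) * C2 * ∑' k : ℤ, 2 ^ (s * k) * S k *
          ∑' m : ℤ, (if m ≤ k then (2 : ℝ≥0∞) ^ ((p - s) * m) else 0) := by
        rw [ENNReal.tsum_comm, ← ENNReal.tsum_mul_left]
        refine tsum_congr fun k => ?_
        rw [ENNReal.tsum_mul_left, ENNReal.tsum_mul_left]
    _ ≤ 2 ^ (w + p) * C2 * ∑' k : ℤ, 2 ^ (s * k) * S k * (G * 2 ^ ((p - s) * k)) := by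
        gcongr with k
        exact hG k
    _ = 2 ^ (w + p) * C2 * (G * ∑' k : ℤ, 2 ^ (p * k) * S k) := by
        rw [← ENNReal.tsum_mul_left (a := (G : ℝ≥0∞))]
        congr 1
        refine tsum_congr fun k => ?_
        calc (2 : ℝ≥0∞) ^ (s * k) * S k * (G * 2 ^ ((p - s) * k))
            = G * ((2 ^ (s * k) * 2 ^ ((p - s) * k)) * S k) := by ring
          _ = _ := by rw [two_rpow_mul]; congr 3; ring
    _ ≤ 2 ^ (w + p) * C2 * (G * 2 ^ (δ * τ)) := by gcongr
    _ = (2 ^ (q * κ + p) * C2 * G) * (2 ^ (q * α * τ) * 2 ^ (δ * τ)) := by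
        rw [show w + p = (q * κ + p) + q * α * τ by rw [hw]; ring, ← two_rpow_mul]
        ring
    _ = _ := by
        rw [two_rpow_mul, ← ENNReal.rpow_mul]
        push_cast
        rw [ENNReal.coe_rpow_of_ne_zero two_ne_zero, ENNReal.coe_ofNat]
        congr 2
        rw [hq]
        field_simp
        ring

theorem mainTheorem2 (n : ℕ) (hn : 1 ≤ n) (δ : ℝ) (hδ : δ ∈ Set.Ioc (0 : ℝ) n)
    (α : ℝ) (hα : α ∈ Set.Ioo 0 δ) (p : ℝ) (hp : p ∈ Set.Ioo (δ / n) (δ / α)) :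
    ∃ c : ℝ≥0, ∀ f : EuclideanSpace ℝ (Fin n) → EReal,
      (choquetIntegral (hausdorffContent δ) Set.univ
          (fun x => rieszPotential (n : ℝ) α f x ^ (δ * p / (δ - p * α))))
            ^ ((δ - p * α) / (δ * p)) ≤
        (c : ℝ≥0∞) *
          (choquetIntegral (hausdorffContent δ) Set.univ (fun x => (f x).abs ^ p)) ^ (1 / p) := by
  obtain ⟨hδ0, hδn⟩ := hδ
  obtain ⟨hα0, hαδ⟩ := hα
  obtain ⟨hp1, hp2⟩ := hp
  have hn0 : (0 : ℝ) < n := by exact_mod_cast hn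
  have hp0 : 0 < p := (div_pos hδ0 hn0).trans hp1
  have hpα : 0 < δ - p * α := by
    rw [lt_div_iff₀ hα0] at hp2
    linarith
  obtain ⟨C, hC⟩ := exists_choquetIntegral_potential_le hδ0 hδn hα0 hαδ hp1 hp2
  obtain ⟨D, hD⟩ := exists_superlevel_covers (n := n) (δ := δ) hp0
  set e : ℝ := (δ - p * α) / δ with he
  have he0 : 0 < e := div_pos hpα hδ0
  refine ⟨((C + 1) ^ e * D) ^ (1 / p), fun f => ?_⟩
  set I := choquetIntegral (hausdorffContent δ) Set.univ (fun x => (f x).abs ^ p) with hI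
  set J := choquetIntegral (hausdorffContent δ) Set.univ
    (fun x => rieszPotential (n : ℝ) α f x ^ (δ * p / (δ - p * α))) with hJ
  have hker : ∀ x, rieszPotential (n : ℝ) α f x = choquetIntegral (hausdorffContent n) Set.univ
      (fun y => (f y).abs * edist x y ^ (-(n - α))) := by
    intro x
    simp only [rieszPotential, div_eq_mul_inv, ENNReal.rpow_neg]
  have hbound : ∀ A : ℝ≥0, D * I < A → J ^ e ≤ C ^ e * A := by
    intro A hA
    have hA0 : A ≠ 0 := by
      rintro rfl
      exact not_lt_zero hA
    obtain ⟨u, hu⟩ := exists_two_rpow_eq hA0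
    obtain ⟨z, r, hcov, hzr⟩ := hD (fun x => (f x).abs) A hA
    have hu' : (A : ℝ≥0∞) = 2 ^ (δ * (u / δ)) := by rw [← hu]; congr 1; field_simp
    rw [hu'] at hzr
    have := hC (u / δ) _ z r hcov hzr
    simp_rw [← hker] at this
    calc J ^ e ≤ (C * (2 ^ (δ * (u / δ))) ^ (δ / (δ - p * α))) ^ e :=
          ENNReal.rpow_le_rpow this he0.le
      _ = C ^ e * A := by
          rw [← hu', ENNReal.mul_rpow_of_nonneg _ _ he0.le, ← ENNReal.rpow_mul,
            show δ / (δ - p * α) * e = 1 by rw [he]; field_simp, ENNReal.rpow_one]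
  have hJI : J ^ e ≤ ((C + 1 : ℝ≥0) : ℝ≥0∞) ^ e * (D * I) := by
    have hc0 : ((C + 1 : ℝ≥0) : ℝ≥0∞) ^ e ≠ 0 := by simp [ENNReal.rpow_eq_zero_iff]
    have hct : ((C + 1 : ℝ≥0) : ℝ≥0∞) ^ e ≠ ∞ := ENNReal.rpow_ne_top_of_nonneg he0.le
      ENNReal.coe_ne_top
    rw [← ENNReal.div_le_iff' hc0 hct]
    refine le_of_forall_gt_imp_ge_of_dense fun A hA => ?_
    by_cases hAt : A = ∞
    · rw [hAt]; exact le_top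
    lift A to ℝ≥0 using hAt
    rw [ENNReal.div_le_iff' hc0 hct]
    refine (hbound A hA).trans ?_
    gcongr
    exact le_self_add
  calc J ^ ((δ - p * α) / (δ * p)) = (J ^ e) ^ (1 / p) := by
        rw [← ENNReal.rpow_mul]; congr 1; rw [he]; field_simp
    _ ≤ (((C + 1 : ℝ≥0) : ℝ≥0∞) ^ e * (D * I)) ^ (1 / p) := ENNReal.rpow_le_rpow hJI (by positivity)
    _ = _ := by
        rw [← mul_assoc, ENNReal.mul_rpow_of_nonneg _ _ (by positivity),
          ENNReal.coe_rpow_of_nonneg _ (by positivity), ENNReal.coe_mul,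
          ENNReal.coe_rpow_of_nonneg _ he0.le]
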